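/- Let $l\ge 0$ and let $M^l$ be the rank $l$ Heisenberg vertex operator algebra with generators $a^i$, $[a^i(m),a^j(n)]=m\,\delta_{m,-n}\delta_{i,j}$, vacuum $\mathbf 1$ and conformal vector $\omega=\frac12\sum_i a^i(-1)^2\mathbf 1$. For $\alpha\in\mathbb C^l$ let $M_\alpha=M^l\otimes e^\alpha$ be the irreducible $M^l$-module on which $a^i(0)$ acts as $\alpha^i$ and $a^i(n)$, $n\ne0$, acts on the first factor, and let $\mathcal M=\bigoplus_{\alpha\in\mathbb C^l}M_\alpha$, where $v\otimes e^0$ is written $v$. Put $\alpha\cdot\beta=\sum_i\alpha^i\beta^i$, $\alpha^2=\alpha\cdot\alpha$, $\alpha(n)=\sum_i\alpha^ia^i(n)$. Let $\epsilon:\mathbb C^l\times\mathbb C^l\to\mathbb C^\times$ be a 2-cocycle, $\epsilon(\alpha,\beta)\epsilon(\alpha+\beta,\gamma)=\epsilon(\alpha,\beta+\gamma)\epsilon(\beta,\gamma)$, with $\epsilon(\alpha,0)=\epsilon(0,\alpha)=1$, put $C(\alpha,\beta)=\epsilon(\alpha,\beta)/\epsilon(\beta,\alpha)$, and let $e^\alpha(v\otimes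 e^\beta)=\epsilon(\alpha,\beta)\,v\otimes e^{\alpha+\beta}$. Define, as formal series in complex powers of $z$, $$\mathcal Y(u\otimes e^\alpha,z)=e^\alpha\,Y_-(\alpha,z)\,Y(u,z)\,Y_+(\alpha,z)\,z^{\alpha(0)},\qquad Y_\pm(\alpha,z)=\exp\Big(\mp\sum_{n>0}\frac{\alpha(\pm n)}{n}z^{\mp n}\Big),$$ where $Y(u,z)$ is the vertex operator of $u\in M^l$ on the modules $M_\beta$, and let $L(n)$ be the Virasoro modes, $\mathcal Y(\omega,z)=\sum_nL(n)z^{-n-2}$. Fix an odd integer $N$ and $\lambda\in\mathbb C^\times$ together with a value of $\log\lambda$, so that $\lambda^\kappa=e^{\kappa\log\lambda}$ and $(e^{i\pi N})^\kappa=e^{i\pi N\kappa}$ for $\kappa\in\mathbb C$, and put $$\mathcal Y^\dagger(u\otimes e^\alpha,z)=\mathcal Y\Big(e^{-z\lambda^{-2}L(1)}\Big(\frac{\lambda}{e^{i\pi N}z}\Big)^{2L(0)}(u\otimes e^\alpha),\ \frac{\lambda^2}{e^{i\pi N}z}\Big).$$ A bilinear form $\langle\,,\rangle$ on $\mathcal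 M$ is called invariant if for all $\alpha,\beta,\gamma\in\mathbb C^l$ and $u,v,w\in M^l$ $$\langle\mathcal Y(u\otimes e^\alpha,z)(v\otimes e^\beta),\,w\otimes e^\gamma\rangle=e^{-i\pi N\alpha\cdot\beta}\,C(\alpha,\beta)\,\langle v\otimes e^\beta,\,\mathcal Y^\dagger(u\otimes e^\alpha,z)(w\otimes e^\gamma)\rangle .$$ **Proposition.** There is exactly one invariant bilinear form on $\mathcal M$ with $\langle\mathbf 1,\mathbf 1\rangle=1$. It is symmetric and invertible, i.e. it is nondegenerate and $x\mapsto\langle x,\cdot\rangle$ is a bijection from $\mathcal M$ onto its graded dual, the space of linear functionals that vanish on all but finitely many of the finite-dimensional spaces $M_{\beta,n}=M^l_n\otimes e^\beta$ ($\beta\in\mathbb C^l$, $n\ge0$, $M^l_n$ the part of $M^l$ of weight $n$). For all $\beta,\gamma\in\mathbb C^l$ and $v,w\in M^l$ it satisfies $$\langle v\otimes e^\beta,w\otimes e^\gamma\rangle=\epsilon(\beta,-\beta)\,\lambda^{-\beta^2}\,\delta_{\beta+\gamma,0}\,\langle v,w\rangle .$$ -/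

import Mathlib

noncomputable section

namespace HeisGVOA

open MvPolynomial

/-- The Fock space of the rank `l` Heisenberg algebra: the polynomial algebra in the creation
operators, the variable `X (i, k)` being `a^i(-k-1)`. The vacuum is `1`, and
`a^{i₁}(-k₁) ⋯ a^{i_r}(-k_r) 𝟏` is the monomial `X (i₁, k₁-1) ⋯ X (i_r, k_r-1)`. -/
abbrev Fock (l : ℕ) : Type := MvPolynomial (Fin l × ℕ) ℂ

/-- `M_α = M^l ⊗ e^α`, summed over all `α ∈ ℂ^l`; the vector `u ⊗ e^α` is
`Finsupp.single α u`. -/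
abbrev BigM (l : ℕ) : Type := (Fin l → ℂ) →₀ Fock l

/-- The Heisenberg mode `a^i(n)` on `M_β` (identified with the Fock space): multiplication by a
variable for `n < 0`, the scalar `β^i` for `n = 0` and `n ∂/∂X(i,n-1)` for `n > 0`. -/
def heis {l : ℕ} (β : Fin l → ℂ) (i : Fin l) : ℤ → (Fock l →ₗ[ℂ] Fock l)
  | Int.ofNat 0 => β i • LinearMap.id
  | Int.ofNat (n + 1) => ((n : ℂ) + 1) • (pderiv (R := ℂ) (i, n)).toLinearMap
  | Int.negSucc k => LinearMap.mulLeft ℂ (X (i, k))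

theorem heis_eq_zero {l : ℕ} (β : Fin l → ℂ) (i : Fin l) (w : Fock l) :
    ∃ K : ℕ, ∀ n : ℕ, K ≤ n → heis β i n w = 0 := by
  classical
  refine ⟨(w.vars.sup Prod.snd) + 2, fun n hn => ?_⟩
  obtain ⟨m, rfl⟩ : ∃ m, n = m + 1 := ⟨n - 1, by omega⟩
  have : pderiv (R := ℂ) (i, m) w = 0 := by
    refine pderiv_eq_zero_of_notMem_vars fun h => ?_
    have h2 : m ≤ w.vars.sup Prod.snd := Finset.le_sup (f := Prod.snd) h
    omega
  change ((m : ℂ) + 1) • (pderiv (R := ℂ) (i, m)) w = 0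
  rw [this, smul_zero]

theorem heis_comm {l : ℕ} (β : Fin l → ℂ) (i j : Fin l) (m n : ℕ) (w : Fock l) :
    heis β i m (heis β j n w) = heis β j n (heis β i m w) := by
  have key : ∀ s t : Fin l × ℕ, pderiv (R := ℂ) s (pderiv (R := ℂ) t w)
      = pderiv (R := ℂ) t (pderiv (R := ℂ) s w) := by
    intro s t
    have h : ⁅(pderiv s : Derivation ℂ (Fock l) (Fock l)), (pderiv t : Derivation ℂ (Fock l) (Fock l))⁆ = 0 := by
      apply MvPolynomial.derivation_ext
      intro r
      classical
      simp only [Derivation.commutator_apply, pderiv_X, Derivation.zero_apply]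
      by_cases h1 : t = r <;> by_cases h2 : s = r <;> simp [h1, h2, eq_comm]
    have := congrArg (fun D => D w) h
    simpa [Derivation.commutator_apply, sub_eq_zero] using this
  rcases m with _ | m <;> rcases n with _ | n
  · change β i • (β j • w) = β j • (β i • w)
    rw [smul_comm]
  · change β i • (((n : ℂ) + 1) • pderiv (R := ℂ) (j, n) w)
      = ((n : ℂ) + 1) • pderiv (R := ℂ) (j, n) (β i • w)
    rw [Derivation.map_smul, smul_comm]
  · change ((m : ℂ) + 1) • pderiv (R := ℂ) (i, m) (β j • w)
      = β j • (((m : ℂ) + 1) • pderiv (R := ℂ) (i, m) w)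
    rw [Derivation.map_smul, smul_comm]
  · change ((m : ℂ) + 1) • pderiv (R := ℂ) (i, m) (((n : ℂ) + 1) • pderiv (R := ℂ) (j, n) w)
      = ((n : ℂ) + 1) • pderiv (R := ℂ) (j, n) (((m : ℂ) + 1) • pderiv (R := ℂ) (i, m) w)
    rw [Derivation.map_smul, Derivation.map_smul, smul_comm, key]

/-- A (lower truncated) field `V(z)`: it sends a vector to a Laurent series in `z`. -/
abbrev Fld (l : ℕ) : Type := Fock l →ₗ[ℂ] HahnSeries ℤ (Fock l)

/-- The creation part of `(1/k!) ∂_z^k a^i(z)`, namely `∑_{j ≥ 0} C(j+k, k) a^i(-j-k-1) z^j`.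
Creation operators are multiplications in the commutative algebra `Fock l`, so that this series
acts on a Laurent series by multiplication. -/
def creationPart {l : ℕ} (i : Fin l) (k : ℕ) : HahnSeries ℤ (Fock l) :=
  HahnSeries.ofPowerSeries ℤ (Fock l)
    (PowerSeries.mk fun j => ((j + k).choose k : Fock l) * X (i, j + k))

/-- `V(z)` times the `n`-th term, `n ≥ 0`, of the annihilation part
`∑_{n ≥ 0} C(-n-1, k) a^i(n) z^{-n-1-k}` of `(1/k!) ∂_z^k a^i(z)`, applied to `w`. -/
def annTerm {l : ℕ} (β : Fin l → ℂ) (i : Fin l) (k : ℕ) (V : Fld l) (w : Fock l) (n : ℕ) :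
    HahnSeries ℤ (Fock l) :=
  HahnSeries.single (-(n : ℤ) - 1 - k) ((Ring.choose (-(n : ℤ) - 1) k : ℤ) : Fock l)
    * V (heis β i n w)

theorem annTerm_finsum {l : ℕ} (β : Fin l → ℂ) (i : Fin l) (k : ℕ) (V : Fld l) (w : Fock l)
    (K : ℕ) (hK : ∀ n : ℕ, K ≤ n → heis β i n w = 0) :
    ∑ᶠ n : ℕ, annTerm β i k V w n = ∑ n ∈ Finset.range K, annTerm β i k V w n := by
  refine finsum_eq_sum_of_support_subset _ fun n hn => ?_
  simp only [Finset.coe_range, Set.mem_Iio]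
  by_contra h
  exact hn (by simp [annTerm, hK n (not_lt.mp h)])

/-- The normally ordered product `: (1/k!) ∂_z^k a^i(z) V(z) :` of fields on `M_β`: creation
operators of `a^i` to the left of `V`, annihilation operators (and the zero mode) to the right. -/
def normalMul {l : ℕ} (β : Fin l → ℂ) (s : Fin l × ℕ) (V : Fld l) : Fld l where
  toFun w := creationPart s.1 s.2 * V w + ∑ᶠ n : ℕ, annTerm β s.1 s.2 V w n
  map_add' v w := by
    obtain ⟨K₁, h₁⟩ := heis_eq_zero β s.1 v
    obtain ⟨K₂, h₂⟩ := heis_eq_zero β s.1 w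
    have hv : ∀ n : ℕ, K₁ + K₂ ≤ n → heis β s.1 n v = 0 := fun n hn => h₁ n (by omega)
    have hw : ∀ n : ℕ, K₁ + K₂ ≤ n → heis β s.1 n w = 0 := fun n hn => h₂ n (by omega)
    rw [annTerm_finsum β s.1 s.2 V v _ hv, annTerm_finsum β s.1 s.2 V w _ hw,
      annTerm_finsum β s.1 s.2 V (v + w) (K₁ + K₂)
        (fun n hn => by rw [map_add, hv n hn, hw n hn, add_zero])]
    simp only [annTerm, map_add, mul_add, Finset.sum_add_distrib]
    abel
  map_smul' c w := by
    obtain ⟨K, h⟩ := heis_eq_zero β s.1 w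
    rw [annTerm_finsum β s.1 s.2 V w _ h, annTerm_finsum β s.1 s.2 V (c • w) K
        (fun n hn => by rw [map_smul, h n hn, smul_zero])]
    have hc : ∀ P x : HahnSeries ℤ (Fock l), P * c • x = c • (P * x) := fun P x => by
      have h1 : ∀ y : HahnSeries ℤ (Fock l), c • y = HahnSeries.C (MvPolynomial.C c) * y :=
        fun y => by
          rw [HahnSeries.C_mul_eq_smul]
          ext1
          funext n
          simp only [HahnSeries.coeff_smul, smul_eq_mul, MvPolynomial.smul_eq_C_mul]
      rw [h1, h1, mul_left_comm]
    simp only [annTerm, map_smul, hc, smul_add, Finset.smul_sum, RingHom.id_apply]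

instance normalMul_leftComm {l : ℕ} (β : Fin l → ℂ) :
    LeftCommutative (normalMul β : Fin l × ℕ → Fld l → Fld l) where
  left_comm s t V := by
    refine LinearMap.ext fun w => ?_
    obtain ⟨K₁, h₁⟩ := heis_eq_zero β s.1 w
    obtain ⟨K₂, h₂⟩ := heis_eq_zero β t.1 w
    have hs : ∀ n : ℕ, K₁ + K₂ ≤ n → heis β s.1 n w = 0 := fun n hn => h₁ n (by omega)
    have ht : ∀ n : ℕ, K₁ + K₂ ≤ n → heis β t.1 n w = 0 := fun n hn => h₂ n (by omega)
    have expand : ∀ s t : Fin l × ℕ, (∀ n : ℕ, K₁ + K₂ ≤ n → heis β s.1 n w = 0) →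
        (∀ n : ℕ, K₁ + K₂ ≤ n → heis β t.1 n w = 0) →
        normalMul β s (normalMul β t V) w =
          creationPart s.1 s.2 * (creationPart t.1 t.2 * V w)
          + creationPart s.1 s.2 * ∑ n ∈ Finset.range (K₁ + K₂), annTerm β t.1 t.2 V w n
          + creationPart t.1 t.2 * ∑ n ∈ Finset.range (K₁ + K₂), annTerm β s.1 s.2 V w n
          + ∑ m ∈ Finset.range (K₁ + K₂), ∑ n ∈ Finset.range (K₁ + K₂),
            HahnSeries.single (-(m : ℤ) - 1 - s.2)
                ((Ring.choose (-(m : ℤ) - 1) s.2 : ℤ) : Fock l) *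
              (HahnSeries.single (-(n : ℤ) - 1 - t.2)
                ((Ring.choose (-(n : ℤ) - 1) t.2 : ℤ) : Fock l) *
                V (heis β t.1 n (heis β s.1 m w))) := by
      intro s t hs ht
      change creationPart s.1 s.2 * (creationPart t.1 t.2 * V w
          + ∑ᶠ n : ℕ, annTerm β t.1 t.2 V w n)
        + ∑ᶠ m : ℕ, annTerm β s.1 s.2 (normalMul β t V) w m = _
      rw [annTerm_finsum β t.1 t.2 V w _ ht,
        annTerm_finsum β s.1 s.2 (normalMul β t V) w _ hs, mul_add, add_assoc, add_assoc,
        add_assoc, Finset.mul_sum (f := fun n => annTerm β s.1 s.2 V w n),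
        ← Finset.sum_add_distrib]
      congr 2
      refine Finset.sum_congr rfl fun m _ => ?_
      have hts : ∀ n : ℕ, K₁ + K₂ ≤ n → heis β t.1 n (heis β s.1 m w) = 0 := fun n hn => by
        rw [heis_comm, ht n hn, map_zero]
      change HahnSeries.single _ _ * (creationPart t.1 t.2 * V (heis β s.1 m w)
          + ∑ᶠ n : ℕ, annTerm β t.1 t.2 V (heis β s.1 m w) n) = _
      rw [annTerm_finsum β t.1 t.2 V _ _ hts, mul_add, Finset.mul_sum]
      congr 1
      simp only [annTerm]
      ring
    rw [expand s t hs ht, expand t s ht hs, Finset.sum_comm]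
    have hsum : ∀ m n : ℕ, V (heis β t.1 n (heis β s.1 m w)) = V (heis β s.1 m (heis β t.1 n w)) :=
      fun m n => by rw [heis_comm]
    simp only [hsum]
    rw [mul_left_comm]
    have hc : ∀ a b c : HahnSeries ℤ (Fock l), a * (b * c) = b * (a * c) := mul_left_comm
    rw [Finset.sum_congr rfl fun n _ => Finset.sum_congr rfl fun m _ => hc _ _ _]
    abel

/-- The vertex operator `Y(u,z)` of the Heisenberg vertex operator algebra acting on the module
`M_β`: the linear extension of
`a^{i₁}(-k₁-1) ⋯ a^{i_r}(-k_r-1) 𝟏 ↦ : (1/k₁!)∂^{k₁}a^{i₁}(z) ⋯ (1/k_r!)∂^{k_r}a^{i_r}(z) :`. -/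
def heisY {l : ℕ} (β : Fin l → ℂ) : Fock l →ₗ[ℂ] Fld l :=
  (basisMonomials (Fin l × ℕ) ℂ).constr ℂ fun d =>
    (Finsupp.toMultiset d).foldr (normalMul β) (HahnSeries.single.linearMap 0)

/-- `exp A = ∑_j A^j / j!` for a power series `A` without constant term, over a possibly
noncommutative algebra; `A^j` then does not contribute to the coefficients of index below `j`. -/
def expSeries {R : Type} [Ring R] [Algebra ℂ R] (A : PowerSeries R) : PowerSeries R :=
  PowerSeries.mk fun m => ∑ j ∈ Finset.range (m + 1),
    ((j.factorial : ℂ)⁻¹) • PowerSeries.coeff m (A ^ j)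

/-- `Y_-(α,z) = exp (∑_{n>0} α(-n) z^n / n)`, `α(n) = ∑ α^i a^i(n)`, a series of creation
operators, i.e. of multiplications. -/
def Yminus {l : ℕ} (α : Fin l → ℂ) : PowerSeries (Fock l) :=
  expSeries (PowerSeries.mk fun n => match n with
    | 0 => 0
    | k + 1 => ((k : ℂ) + 1)⁻¹ • ∑ i, α i • X (i, k))

/-- `Y_+(α,z) = exp (-∑_{n>0} α(n) z^{-n} / n)`, as a power series in `z⁻¹` with coefficients in
the operators on Fock space. (The modes `a^i(n)`, `n ≠ 0`, are the same on all `M_β`.) -/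
def Yplus {l : ℕ} (α : Fin l → ℂ) : PowerSeries (Module.End ℂ (Fock l)) :=
  expSeries (PowerSeries.mk fun n => match n with
    | 0 => 0
    | k + 1 => -(((k : ℂ) + 1)⁻¹ • ∑ i, α i • heis 0 i ((k : ℤ) + 1)))

/-- `Y_-(α,z) Y(u,z) Y_+(α,z) v` for `v ∈ M_β`; only finitely many coefficients of
`Y_+(α,z) v` are nonzero. -/
def coreSeries {l : ℕ} (α β : Fin l → ℂ) (u v : Fock l) : HahnSeries ℤ (Fock l) :=
  HahnSeries.ofPowerSeries ℤ (Fock l) (Yminus α) *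
    ∑ᶠ m : ℕ, HahnSeries.single (-(m : ℤ)) (1 : Fock l) *
      heisY β u (PowerSeries.coeff m (Yplus α) v)

open Classical in
/-- The coefficient of `z^κ`, `κ ∈ ℂ`, in `z^c f(z)` for a Laurent series `f`. -/
def coeffShift {l : ℕ} (c : ℂ) (f : HahnSeries ℤ (Fock l)) (κ : ℂ) : Fock l :=
  if h : ∃ n : ℤ, c + n = κ then f.coeff h.choose else 0

/-- A normalized 2-cocycle `ε` on the additive group `ℂ^l` with values in `ℂˣ`; the cocycle law
says that the operators `e^α (v ⊗ e^β) = ε(α,β) v ⊗ e^{α+β}` satisfy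
`e^α e^β = ε(α,β) e^{α+β}`. -/
structure Cocycle (l : ℕ) where
  ε : (Fin l → ℂ) → (Fin l → ℂ) → ℂˣ
  zero_left : ∀ α, ε 0 α = 1
  zero_right : ∀ α, ε α 0 = 1
  cocycle : ∀ α β γ, ε α (β + γ) * ε β γ = ε α β * ε (α + β) γ

/-- The commutator function `C(α,β) = ε(α,β) / ε(β,α)`. -/
def Cocycle.comm {l : ℕ} (c : Cocycle l) (α β : Fin l → ℂ) : ℂˣ := c.ε α β / c.ε β α

/-- The coefficient of `z^κ` in `𝒴(x,z) y`, where
`𝒴(u ⊗ e^α, z) = e^α Y_-(α,z) Y(u,z) Y_+(α,z) z^{α(0)}` and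
`e^α (v ⊗ e^β) = ε(α,β) v ⊗ e^{α+β}`. -/
def vertexCoeff {l : ℕ} (c : Cocycle l) (x : BigM l) (κ : ℂ) (y : BigM l) : BigM l :=
  x.sum fun α u => y.sum fun β v =>
    Finsupp.single (α + β)
      ((c.ε α β : ℂ) • coeffShift (α ⬝ᵥ β) (coreSeries α β u v) κ)

/-- The vacuum vector `𝟏`. -/
def vac (l : ℕ) : BigM l := Finsupp.single 0 1

/-- The conformal vector `ω = (1/2) ∑_i a^i(-1)² 𝟏`. -/
def omega (l : ℕ) : BigM l := Finsupp.single 0 ((2 : ℂ)⁻¹ • ∑ i, X (i, 0) ^ 2)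

/-- The Virasoro operator `L(n)` on `ℳ`, from `𝒴(ω,z) = ∑ L(n) z^{-n-2}`. -/
def vir {l : ℕ} (c : Cocycle l) (n : ℤ) (x : BigM l) : BigM l :=
  vertexCoeff c (omega l) (-(n : ℂ) - 2) x

/-- The weight `∑ k_j` of the Fock monomial `a^{i₁}(-k₁) ⋯ a^{i_r}(-k_r) 𝟏`. -/
def fockWeight {l : ℕ} (d : Fin l × ℕ →₀ ℕ) : ℕ := Finsupp.weight (fun s => s.2 + 1) d

/-- The `L(0)`-eigenvalue of a Fock monomial tensored with `e^α`. -/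
def confWeight {l : ℕ} (α : Fin l → ℂ) (d : Fin l × ℕ →₀ ℕ) : ℂ :=
  (fockWeight d : ℂ) + (α ⬝ᵥ α) / 2

theorem expSeries_zero {R : Type} [Ring R] [Algebra ℂ R] : expSeries (0 : PowerSeries R) = 1 := by
  ext m
  simp only [expSeries, PowerSeries.coeff_mk]
  rw [Finset.sum_eq_single 0]
  · simp
  · intro j _ hj
    simp [hj]
  · simp

theorem Yminus_zero {l : ℕ} : Yminus (0 : Fin l → ℂ) = 1 := by
  rw [← expSeries_zero, Yminus]
  congr 1
  ext1 n
  cases n <;> simp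

theorem Yplus_zero {l : ℕ} : Yplus (0 : Fin l → ℂ) = 1 := by
  rw [← expSeries_zero, Yplus]
  congr 1
  refine PowerSeries.ext fun n => ?_
  cases n <;> simp

theorem coreSeries_zero {l : ℕ} (β : Fin l → ℂ) (u v : Fock l) :
    coreSeries 0 β u v = heisY β u v := by
  rw [coreSeries, Yminus_zero, Yplus_zero, map_one, one_mul, finsum_eq_single _ 0]
  · simp
  · intro m hm
    simp [PowerSeries.coeff_one, hm]

theorem coeffShift_int {l : ℕ} (c : ℂ) (f : HahnSeries ℤ (Fock l)) (n : ℤ) :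
    coeffShift c f (c + n) = f.coeff n := by
  have h : ∃ m : ℤ, c + m = c + n := ⟨n, rfl⟩
  rw [coeffShift, dif_pos h]
  congr 1
  have := h.choose_spec
  simpa using this

theorem heisY_monomial {l : ℕ} (β : Fin l → ℂ) (d : Fin l × ℕ →₀ ℕ) :
    heisY β (monomial d 1) =
      (Finsupp.toMultiset d).foldr (normalMul β) (HahnSeries.single.linearMap 0) := by
  have := (basisMonomials (Fin l × ℕ) ℂ).constr_basis ℂ (fun d =>
    (Finsupp.toMultiset d).foldr (normalMul β) (HahnSeries.single.linearMap 0)) d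
  simpa [heisY] using this

theorem heisY_sq {l : ℕ} (β : Fin l → ℂ) (i : Fin l) :
    heisY β (X (i, 0) ^ 2) =
      normalMul β (i, 0) (normalMul β (i, 0) (HahnSeries.single.linearMap 0)) := by
  rw [X_pow_eq_monomial, heisY_monomial, Finsupp.toMultiset_single]
  rw [two_nsmul]
  change Multiset.foldr _ _ ((i,0) ::ₘ (i,0) ::ₘ 0) = _
  simp

theorem creation_coeff_neg {l : ℕ} (i : Fin l) (v : Fock l) (m : ℕ) (hm : 0 < m) :
    (creationPart i 0 * HahnSeries.single (-(m : ℤ)) v).coeff (-2)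
      = if 2 ≤ m then X (i, m - 2) * v else 0 := by
  have := HahnSeries.coeff_mul_single_add (r := v) (x := creationPart i 0) (a := (m : ℤ) - 2)
    (b := -(m : ℤ))
  rw [show (m : ℤ) - 2 + -(m : ℤ) = -2 by ring] at this
  rw [this]
  split_ifs with h
  · obtain ⟨k, rfl⟩ : ∃ k, m = k + 2 := ⟨m - 2, by omega⟩
    rw [show ((k + 2 : ℕ) : ℤ) - 2 = (k : ℤ) by push_cast; ring]
    rw [creationPart, HahnSeries.ofPowerSeries_apply_coeff]
    simp
  · have hm1 : m = 1 := by omega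
    subst hm1
    rw [creationPart, HahnSeries.ofPowerSeries_apply, HahnSeries.embDomain_of_notMem_range, zero_mul]
    simp

theorem normalMul_coeff {l : ℕ} (β : Fin l → ℂ) (i : Fin l) (v : Fock l) (K : ℕ)
    (hK : ∀ n : ℕ, K ≤ n → heis β i n v = 0) (hK0 : 0 < K) :
    (normalMul β (i, 0) (normalMul β (i, 0) (HahnSeries.single.linearMap 0)) v).coeff (-2)
      = (2 : ℂ) • (∑ n ∈ Finset.range K, X (i, n) * heis β i ((n + 1 : ℕ) : ℤ) v)
        + (β i ^ 2) • v := by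
  have hin : ∀ w : Fock l, (∀ n : ℕ, K ≤ n → heis β i n w = 0) →
      normalMul β (i, 0) (HahnSeries.single.linearMap (R := ℂ) 0) w =
        creationPart i 0 * HahnSeries.single 0 w
        + ∑ n ∈ Finset.range K, HahnSeries.single (-((n + 1 : ℕ) : ℤ)) (heis β i n w) := by
    intro w hw
    change creationPart i 0 * HahnSeries.single 0 w
        + ∑ᶠ n : ℕ, annTerm β i 0 (HahnSeries.single.linearMap 0) w n = _
    rw [annTerm_finsum β i 0 _ w K hw]
    congr 1
    refine Finset.sum_congr rfl fun n _ => ?_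
    simp only [annTerm]
    change HahnSeries.single _ _ * HahnSeries.single 0 _ = _
    rw [HahnSeries.single_mul_single]
    simp
    ring_nf
  have hPP : (creationPart i 0 * (creationPart i 0 * HahnSeries.single 0 v)).coeff (-2) = 0 := by
    rw [← mul_assoc]
    have := HahnSeries.coeff_mul_single_add (r := v) (x := creationPart i 0 * creationPart i 0)
      (a := -2) (b := 0)
    rw [add_zero] at this
    rw [this, creationPart, ← map_mul, HahnSeries.ofPowerSeries_apply,
      HahnSeries.embDomain_of_notMem_range, zero_mul]
    simp
  have hrange : ∀ F : ℕ → Fock l, F K = 0 →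
      ∑ n ∈ Finset.range K, (if 2 ≤ n + 1 then F n else 0)
        = ∑ n ∈ Finset.range K, F (n + 1) := by
    intro F hF
    obtain ⟨K', rfl⟩ : ∃ K', K = K' + 1 := ⟨K - 1, by omega⟩
    rw [Finset.sum_range_succ', Finset.sum_range_succ, hF]
    simp
  change (creationPart i 0 * normalMul β (i, 0) (HahnSeries.single.linearMap 0) v
    + ∑ᶠ m : ℕ, annTerm β i 0 (normalMul β (i, 0) (HahnSeries.single.linearMap 0)) v m).coeff (-2)
    = _
  rw [annTerm_finsum β i 0 _ v K hK, hin v hK, mul_add, Finset.mul_sum]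
  simp only [annTerm]
  have hin2 := fun m : ℕ => hin (heis β i m v) (fun n hn => by rw [heis_comm, hK n hn, map_zero])
  simp only [hin2]
  simp only [mul_add, Finset.sum_add_distrib, HahnSeries.coeff_add, HahnSeries.coeff_sum, hPP,
    zero_add]
  have hcr := fun n : ℕ => creation_coeff_neg i (heis β i n v) (n + 1) (by omega)
  have h2 : ∀ m : ℕ, (HahnSeries.single (-(m : ℤ) - 1 - ((0 : ℕ) : ℤ))
      ((Ring.choose (-(m : ℤ) - 1) 0 : ℤ) : Fock l) *
      (creationPart i 0 * HahnSeries.single 0 (heis β i m v))).coeff (-2)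
      = if 2 ≤ m + 1 then X (i, m + 1 - 2) * heis β i m v else 0 := by
    intro m
    rw [mul_left_comm, HahnSeries.single_mul_single,
      ← creation_coeff_neg i (heis β i m v) (m + 1) (by omega)]
    simp
    ring_nf
  have h3 : ∀ m : ℕ, (HahnSeries.single (-(m : ℤ) - 1 - ((0 : ℕ) : ℤ))
      ((Ring.choose (-(m : ℤ) - 1) 0 : ℤ) : Fock l) *
      ∑ n ∈ Finset.range K, HahnSeries.single (-((n + 1 : ℕ) : ℤ))
        (heis β i n (heis β i m v))).coeff (-2)
      = if m = 0 then heis β i 0 (heis β i 0 v) else 0 := by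
    intro m
    rw [Finset.mul_sum, HahnSeries.coeff_sum, Finset.sum_eq_single 0]
    · rw [HahnSeries.single_mul_single]
      split_ifs with h
      · subst h; simp
      · rw [HahnSeries.coeff_single_of_ne]; push_cast; omega
    · intro n _ hn
      rw [HahnSeries.single_mul_single, HahnSeries.coeff_single_of_ne]; push_cast; omega
    · intro h; exact absurd (Finset.mem_range.mpr hK0) h
  simp only [hcr, h2, h3]
  rw [hrange (fun n => X (i, n + 1 - 2) * heis β i n v) (by simp [hK K le_rfl])]
  rw [Finset.sum_ite_eq' (Finset.range K) 0, if_pos (Finset.mem_range.mpr hK0), ← add_assoc,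
    two_smul]
  congr 1
  change β i • (β i • v) = _
  rw [smul_smul, sq]

/-- `L(0)` acts on a Fock monomial tensored with `e^α` by `confWeight`. -/
theorem vir_zero_monomial {l : ℕ} (c : Cocycle l) (α : Fin l → ℂ) (d : Fin l × ℕ →₀ ℕ) (r : ℂ) :
    vir c 0 (Finsupp.single α (monomial d r))
      = confWeight α d • Finsupp.single α (monomial d r) := by
  have h0 : vir c 0 (Finsupp.single α (monomial d r)) = Finsupp.single α
      ((heisY α ((2 : ℂ)⁻¹ • ∑ i, X (i, 0) ^ 2) (monomial d r)).coeff (-2)) := by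
    have hz : coeffShift (0 ⬝ᵥ α) (0 : HahnSeries ℤ (Fock l)) (-((0:ℤ) : ℂ) - 2) = 0 := by
      rw [coeffShift]; split_ifs <;> simp
    rw [vir, vertexCoeff, omega, Finsupp.sum_single_index, Finsupp.sum_single_index, zero_add,
      c.zero_left, coreSeries_zero]
    · have := coeffShift_int (0 ⬝ᵥ α) (heisY α ((2 : ℂ)⁻¹ • ∑ i, X (i, 0) ^ 2) (monomial d r)) (-2)
      rw [show (-((0 : ℤ) : ℂ) - 2) = 0 ⬝ᵥ α + ((-2 : ℤ) : ℂ) by simp, this, Units.val_one,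
        one_smul]
    · rw [coreSeries_zero, map_zero, hz]; simp
    · rw [Finsupp.sum_single_index]
      · rw [coreSeries_zero, map_zero, LinearMap.zero_apply, hz]; simp
      · rw [coreSeries_zero, map_zero, hz]; simp
  have h1 : ∀ i, (heisY α (X (i, 0) ^ 2) (monomial d r)).coeff (-2)
      = (2 * ∑ k ∈ Finset.range (d.support.sup Prod.snd + 2), ((k : ℂ) + 1) * d (i, k)
          + α i ^ 2) • monomial d r := by
    intro i
    have hd : ∀ k, d.support.sup Prod.snd + 1 ≤ k → d (i, k) = 0 := fun k hk => by
      by_contra hne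
      have : k ≤ d.support.sup Prod.snd :=
        Finset.le_sup (f := Prod.snd) (Finsupp.mem_support_iff.mpr hne)
      omega
    rw [heisY_sq, normalMul_coeff α i _ (d.support.sup Prod.snd + 2) _ (by omega), add_smul,
      mul_smul, Finset.sum_smul]
    · congr 2
      refine Finset.sum_congr rfl fun k _ => ?_
      change X (i, k) * (((k : ℂ) + 1) • pderiv (R := ℂ) (i, k) (monomial d r)) = _
      rw [mul_smul_comm, X_mul_pderiv_monomial, mul_smul, Nat.cast_smul_eq_nsmul]
    · intro n hn
      obtain ⟨k, rfl⟩ : ∃ k, n = k + 1 := ⟨n - 1, by omega⟩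
      change ((k : ℂ) + 1) • pderiv (R := ℂ) (i, k) (monomial d r) = 0
      rw [pderiv_monomial, hd k (by omega)]
      simp
  have hw : (fockWeight d : ℂ)
      = ∑ i, ∑ k ∈ Finset.range (d.support.sup Prod.snd + 2), ((k : ℂ) + 1) * d (i, k) := by
    rw [fockWeight, Finsupp.weight_apply, Finsupp.sum, ← Finset.sum_product']
    rw [Finset.sum_subset (s₂ := Finset.univ ×ˢ Finset.range (d.support.sup Prod.snd + 2))]
    · push_cast
      refine Finset.sum_congr rfl fun s _ => ?_
      simp [mul_comm]
    · intro s hs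
      have : s.2 ≤ d.support.sup Prod.snd := Finset.le_sup (f := Prod.snd) hs
      simp
      omega
    · intro s _ hs
      simp [Finsupp.notMem_support_iff.mp hs]
  rw [h0, Finsupp.smul_single, map_smul, map_sum]
  simp only [LinearMap.smul_apply, LinearMap.sum_apply, HahnSeries.coeff_smul,
    HahnSeries.coeff_sum, h1]
  rw [← Finset.sum_smul, smul_smul, confWeight, hw, Finset.sum_add_distrib, ← Finset.mul_sum]
  congr 2
  simp only [dotProduct, sq]
  ring
/-- `λ^κ` for the choice `logLam` of `log λ`. -/
def lamPow (logLam κ : ℂ) : ℂ := Complex.exp (κ * logLam)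

/-- The branch factor `(e^{iπN})^κ = e^{iπNκ}`. -/
def branch (N : ℤ) (κ : ℂ) : ℂ := Complex.exp (Real.pi * Complex.I * N * κ)

/-- `(λ / (e^{iπN} z))^{2 L(0)} x`, as the finitely supported function sending `ρ` to the
coefficient of `z^ρ`. On a vector of weight `h` this is `λ^{2h} e^{-2πiNh} z^{-2h}`. -/
def scaleL0 {l : ℕ} (N : ℤ) (logLam : ℂ) (x : BigM l) : ℂ →₀ BigM l :=
  x.sum fun α u => ∑ d ∈ u.support,
    Finsupp.single (-(2 * confWeight α d))
      ((lamPow logLam (2 * confWeight α d) * branch N (-(2 * confWeight α d))) •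
        Finsupp.single α (monomial d (coeff d u)))

/-- `e^{-z λ^{-2} L(1)}` applied to a finite sum `∑_ρ x_ρ z^ρ`; `L(1)` is locally nilpotent. -/
def expL1 {l : ℕ} (c : Cocycle l) (logLam : ℂ) (p : ℂ →₀ BigM l) : ℂ →₀ BigM l :=
  p.sum fun ρ x => ∑ᶠ j : ℕ, Finsupp.single (ρ + j)
    (((j.factorial : ℂ)⁻¹ * (-lamPow logLam (-2)) ^ j) • (vir c 1)^[j] x)

/-- The coefficient of `z^κ` in the adjoint vertex operator
`𝒴†(x,z) y = 𝒴(e^{-z λ^{-2} L(1)} (λ / (e^{iπN} z))^{2 L(0)} x, λ² / (e^{iπN} z)) y`. A term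
`z^ρ (λ² / (e^{iπN} z))^μ` is `λ^{2μ} e^{-iπNμ} z^{ρ-μ}`, so `μ = ρ - κ`. -/
def daggerCoeff {l : ℕ} (c : Cocycle l) (N : ℤ) (logLam : ℂ) (x : BigM l) (κ : ℂ) (y : BigM l) :
    BigM l :=
  (expL1 c logLam (scaleL0 N logLam x)).sum fun ρ x' =>
    (lamPow logLam (2 * (ρ - κ)) * branch N (-(ρ - κ))) • vertexCoeff c x' (ρ - κ) y

/-- Invariance of a bilinear form on `ℳ`:
`⟨𝒴(u⊗e^α,z)(v⊗e^β), w⊗e^γ⟩ = e^{-iπN α·β} C(α,β) ⟨v⊗e^β, 𝒴†(u⊗e^α,z)(w⊗e^γ)⟩`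
as an identity of formal series in complex powers of `z`. -/
def IsInvariant {l : ℕ} (c : Cocycle l) (N : ℤ) (logLam : ℂ)
    (B : LinearMap.BilinForm ℂ (BigM l)) : Prop :=
  ∀ (α β γ : Fin l → ℂ) (u v w : Fock l) (κ : ℂ),
    B (vertexCoeff c (Finsupp.single α u) κ (Finsupp.single β v)) (Finsupp.single γ w)
      = branch N (-(α ⬝ᵥ β)) * (c.comm α β : ℂ) *
        B (Finsupp.single β v)
          (daggerCoeff c N logLam (Finsupp.single α u) κ (Finsupp.single γ w))

/-- The graded dual of `ℳ`: the functionals that vanish on all but finitely many of the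
finite-dimensional spaces `M_{β,n}` spanned by `u ⊗ e^β` with `u` of weight `n`. -/
def gradedDual (l : ℕ) : Set (Module.Dual ℂ (BigM l)) :=
  {f | {p : (Fin l → ℂ) × ℕ | ∃ u : Fock l,
    IsWeightedHomogeneous (fun s : Fin l × ℕ => s.2 + 1) u p.2 ∧
      f (Finsupp.single p.1 u) ≠ 0}.Finite}

/-- A bilinear form is invertible if `x ↦ ⟨x, ·⟩` is a bijection of `ℳ` onto its graded dual. -/
def IsInvertible {l : ℕ} (B : LinearMap.BilinForm ℂ (BigM l)) : Prop :=
  Function.Injective B ∧ Set.range B = gradedDual l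

end HeisGVOA

end

noncomputable section

namespace HeisGVOA

open MvPolynomial Filter

/-! Put q = -λ². Since N is odd, λ²/(e^{iπN} z) is q/z as far as integral powers are concerned.
Invariance for a^i(-1)𝟏 alone forces the adjoint of a^i(m) to be -q^m a^i(-m), and everything is
built on this.

Uniqueness. Let an invariant form vanish at (𝟏, 𝟏). Comparing the zero modes gives ⟨𝟏, e^γ⟩ = 0 for
γ ≠ 0. Moving creation operators to the other side, where they become annihilation operators, gives
⟨𝟏, ℳ⟩ = 0. As e^β is the constant coefficient of 𝒴(e^β, z)𝟏, invariance for e^β then gives ⟨e^β,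
e^γ⟩ = 0, and moving creation operators once more kills the form (`IsInvariant.eq_zero`). The
difference of two normalized invariant forms is such a form.

Existence. On Fock space the monomials are declared orthogonal, with the norms that the adjoints
above dictate (`fockForm`); M_β is paired with M_{-β} by this form times ε(β,-β) λ^{-β²}. Invariance
splits into an operator identity and a scalar identity. The operator identity says that the field F
= Y_-(α,z) Y(u,z) Y_+(α,z) on M_β has as adjoint, with ζ = q/z, the field attached to (-q)^{-n}
ζ^{2n} e^{ζ^{-1} L(1)} u on M_{-(α+β)}, n being the weight of u (`fieldAdjoint_coreField`). It is
proved by adding one creation operator to u at a time. For u = 𝟏 it holds because Y_- and Y_+ are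
exchanged by taking adjoints (`fieldAdjoint_coreField_one`). In the inductive step the adjoint of
:∂^{(k)}a^i(z) V(z): is expanded by a Vandermonde identity (`FieldAdjoint.normalMul`), and L(1),
which acts on M_α as a derivation of the polynomial algebra, has the same binomial coefficients in
its divided powers. The two sides live on different momenta, -β and -(α+β); the resulting
discrepancy, a multiple of α^i, is exactly the term in which L(1)^{k+1}/(k+1)! reduces a^i(-k-1) to
the zero mode α^i (`adjointField_X_mul`).

The scalar identity compares the powers of λ and of e^{iπN}, and uses the cocycle law at (β, α,
-(α+β)) (`isInvariant_bigForm`). Symmetry follows from ε(β,-β) = ε(-β,β). Invertibility follows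
because the monomials are orthogonal with nonzero norms and each weight space has finitely many of
them. -/

/-! ### Exponentials of power series -/

/-- A graded relation that is additive, homogeneous, contains `(1, 1)` and reverses products passes
from the coefficients of two power series to those of their exponentials. -/
theorem coeff_expSeries_rel {R S : Type} [Ring R] [Algebra ℂ R] [Ring S] [Algebra ℂ S]
    {P : ℕ → R → S → Prop} (hzero : ∀ m, P m 0 0) (hone : P 0 1 1)
    (hadd : ∀ m x y x' y', P m x x' → P m y y' → P m (x + y) (x' + y'))
    (hsmul : ∀ m (r : ℂ) x x', P m x x' → P m (r • x) (r • x'))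
    (hmul : ∀ m n x y x' y', P m x x' → P n y y' → P (m + n) (x * y) (y' * x'))
    {A : PowerSeries R} {B : PowerSeries S}
    (h : ∀ m, P m (PowerSeries.coeff m A) (PowerSeries.coeff m B)) (m : ℕ) :
    P m (PowerSeries.coeff m (expSeries A)) (PowerSeries.coeff m (expSeries B)) := by
  have hsum : ∀ {ι : Type} (s : Finset ι) (m : ℕ) (f : ι → R) (g : ι → S),
      (∀ i ∈ s, P m (f i) (g i)) → P m (∑ i ∈ s, f i) (∑ i ∈ s, g i) := by
    intro ι s m f g hs
    classical
    induction s using Finset.induction_on with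
    | empty => simpa using hzero m
    | insert a s ha ih =>
      rw [Finset.sum_insert ha, Finset.sum_insert ha]
      exact hadd _ _ _ _ _ (hs a (by simp)) (ih fun i hi => hs i (by simp [hi]))
  have hpow : ∀ j m, P m (PowerSeries.coeff m (A ^ j)) (PowerSeries.coeff m (B ^ j)) := by
    intro j
    induction j with
    | zero =>
      intro m
      simp only [pow_zero, PowerSeries.coeff_one]
      split_ifs with hm
      · subst hm; exact hone
      · exact hzero m
    | succ j ih =>
      intro m
      rw [pow_succ A, pow_succ' B, PowerSeries.coeff_mul, PowerSeries.coeff_mul,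
        ← Finset.Nat.sum_antidiagonal_swap (f := fun p => PowerSeries.coeff p.1 B * _)]
      refine hsum _ _ _ _ fun p hp => ?_
      have := hmul _ _ _ _ _ _ (ih p.1) (h p.2)
      rwa [Finset.HasAntidiagonal.mem_antidiagonal.mp hp] at this
  simp only [expSeries, PowerSeries.coeff_mk]
  exact hsum _ _ _ _ fun j _ => hsmul _ _ _ _ (hpow j m)

/-! ### The weight filtration of Fock space -/

/-- The polynomials all of whose monomials have weight less than `K`. -/
def weightLT (l K : ℕ) : Submodule ℂ (Fock l) where
  carrier := {v | ∀ d, coeff d v ≠ 0 → fockWeight d < K}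
  add_mem' := by
    intro a b ha hb d hd
    by_contra h
    rw [coeff_add, not_imp_comm.mp (ha d) h, not_imp_comm.mp (hb d) h, add_zero] at hd
    exact hd rfl
  zero_mem' := by simp
  smul_mem' := by
    intro r v hv d hd
    refine hv d fun h => hd ?_
    rw [coeff_smul, h, smul_zero]

theorem weightLT_zero {l : ℕ} {v : Fock l} (h : v ∈ weightLT l 0) : v = 0 := by
  ext d
  by_contra hd
  exact absurd (h d hd) (by omega)

theorem exists_mem_weightLT {l : ℕ} (v : Fock l) : ∃ K, v ∈ weightLT l K := by
  refine ⟨v.support.sup fockWeight + 1, fun d hd => ?_⟩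
  have := Finset.le_sup (f := fockWeight) (mem_support_iff.mpr hd)
  omega

theorem fockWeight_add {l : ℕ} (d e : Fin l × ℕ →₀ ℕ) :
    fockWeight (d + e) = fockWeight d + fockWeight e := by
  simp [fockWeight]

theorem fockWeight_single {l : ℕ} (s : Fin l × ℕ) (n : ℕ) :
    fockWeight (Finsupp.single s n) = n * (s.2 + 1) := by
  simp [fockWeight, Finsupp.weight_apply]

/-- `T` lowers weights by at least `r`. -/
def LowersWeight {l : ℕ} (r : ℕ) (T : Module.End ℂ (Fock l)) : Prop :=
  ∀ K, ∀ v ∈ weightLT l K, T v ∈ weightLT l (K - r)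

theorem lowersWeight_pderiv {l : ℕ} (s : Fin l × ℕ) :
    LowersWeight (s.2 + 1) (pderiv (R := ℂ) s).toLinearMap := by
  intro K v hv d hd
  change coeff d (pderiv s v) ≠ 0 at hd
  rw [coeff_pderiv] at hd
  have := hv _ (left_ne_zero_of_mul hd)
  rw [fockWeight_add, fockWeight_single] at this
  omega

theorem LowersWeight.add {l r : ℕ} {S T : Module.End ℂ (Fock l)} (hS : LowersWeight r S)
    (hT : LowersWeight r T) : LowersWeight r (S + T) :=
  fun K v hv => add_mem (hS K v hv) (hT K v hv)

theorem LowersWeight.smul {l r : ℕ} {T : Module.End ℂ (Fock l)} (a : ℂ)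
    (hT : LowersWeight r T) : LowersWeight r (a • T) :=
  fun K v hv => Submodule.smul_mem _ _ (hT K v hv)

theorem LowersWeight.neg {l r : ℕ} {T : Module.End ℂ (Fock l)} (hT : LowersWeight r T) :
    LowersWeight r (-T) :=
  fun K v hv => neg_mem (hT K v hv)

theorem LowersWeight.zero {l r : ℕ} : LowersWeight r (0 : Module.End ℂ (Fock l)) :=
  fun _ _ _ => zero_mem _

theorem LowersWeight.mul {l r s : ℕ} {S T : Module.End ℂ (Fock l)} (hS : LowersWeight r S)
    (hT : LowersWeight s T) : LowersWeight (r + s) (S * T) := fun K v hv => by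
  have := hS _ _ (hT K v hv)
  rwa [Nat.sub_sub, add_comm] at this

theorem LowersWeight.sum {l r : ℕ} {ι : Type} (s : Finset ι) {T : ι → Module.End ℂ (Fock l)}
    (hT : ∀ i ∈ s, LowersWeight r (T i)) : LowersWeight r (∑ i ∈ s, T i) := fun K v hv => by
  rw [LinearMap.sum_apply]
  exact sum_mem fun i hi => hT i hi K v hv

/-! ### Exponentials of annihilation operators -/

theorem heis_add_one {l : ℕ} (β : Fin l → ℂ) (i : Fin l) (k : ℕ) :
    heis β i ((k : ℤ) + 1) = ((k : ℂ) + 1) • (pderiv (R := ℂ) (i, k)).toLinearMap := rfl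

theorem heis_negSucc {l : ℕ} (β : Fin l → ℂ) (i : Fin l) (k : ℕ) (v : Fock l) :
    heis β i (-((k : ℤ) + 1)) v = X (i, k) * v := by
  rw [show -((k : ℤ) + 1) = Int.negSucc k by omega]
  rfl

theorem heis_zero {l : ℕ} (β : Fin l → ℂ) (i : Fin l) (v : Fock l) :
    heis β i 0 v = β i • v := rfl

theorem lowersWeight_heis {l : ℕ} (β : Fin l → ℂ) (i : Fin l) (n : ℕ) :
    LowersWeight n (heis β i n) := by
  cases n with
  | zero => exact fun K v hv => Submodule.smul_mem _ _ hv
  | succ k => exact (lowersWeight_pderiv (i, k)).smul _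

/-- The exponent of Y_+ has a weight-lowering operator of the right degree in each coefficient, and
exponentials respect the grading. Consequently only finitely many coefficients of Y_+ act
nontrivially on a given vector. -/
theorem lowersWeight_Yplus {l : ℕ} (α : Fin l → ℂ) (m : ℕ) :
    LowersWeight m (PowerSeries.coeff m (Yplus α)) := by
  -- A property of a single series: the relation ignores its second argument, so the zero series
  -- serves there.
  refine coeff_expSeries_rel (P := fun m x (_ : ℂ) => LowersWeight m x)
    (fun _ => LowersWeight.zero) (fun K v hv => by simpa using hv)
    (fun _ _ _ _ _ h h' => h.add h') (fun _ r _ _ h => h.smul r)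
    (fun _ _ _ _ _ _ h h' => h.mul h') (B := 0) (fun m => ?_) m
  rw [PowerSeries.coeff_mk]
  cases m with
  | zero => exact LowersWeight.zero
  | succ k =>
    exact ((LowersWeight.sum _ fun i _ => (lowersWeight_heis 0 i (k + 1)).smul _).smul _).neg

theorem Yplus_eventually_zero {l : ℕ} (α : Fin l → ℂ) (v : Fock l) :
    ∀ᶠ M : ℕ in Filter.atTop, ∀ m, M ≤ m → PowerSeries.coeff m (Yplus α) v = 0 := by
  obtain ⟨K, hK⟩ := exists_mem_weightLT v
  filter_upwards [Filter.eventually_ge_atTop K] with M hM m hm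
  have := lowersWeight_Yplus α m K v hK
  rw [Nat.sub_eq_zero_of_le (by omega)] at this
  exact weightLT_zero this

theorem heis_eventually_zero {l : ℕ} (β : Fin l → ℂ) (i : Fin l) (v : Fock l) :
    ∀ᶠ M : ℕ in Filter.atTop, ∀ m : ℕ, M ≤ m → heis β i m v = 0 := by
  obtain ⟨K, hK⟩ := heis_eq_zero β i v
  filter_upwards [Filter.eventually_ge_atTop K] with M hM m hm
  exact hK m (hM.trans hm)

/-- Modes of nonnegative index commute with each other. This is what lets the annihilation part of a
normally ordered factor pass through Y_+ in `coreField_X_mul`. -/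
theorem heis_Yplus_comm {l : ℕ} (α β : Fin l → ℂ) (i : Fin l) (n m : ℕ) (v : Fock l) :
    heis β i n (PowerSeries.coeff m (Yplus α) v) = PowerSeries.coeff m (Yplus α) (heis β i n v) := by
  revert v
  refine coeff_expSeries_rel (P := fun _ (x : Module.End ℂ (Fock l)) (_ : ℂ) =>
    ∀ v, heis β i n (x v) = x (heis β i n v)) (by simp) (by simp) ?_ ?_ ?_ (B := 0) (fun m => ?_) m
  · intro m x y _ _ hx hy v
    simp [hx, hy]
  · intro m r x _ hx v
    simp [hx]
  · intro m n x y _ _ hx hy v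
    simp [hx, hy]
  · intro v
    rw [PowerSeries.coeff_mk]
    cases m with
    | zero => simp
    | succ k =>
      simp only [LinearMap.neg_apply, LinearMap.smul_apply, LinearMap.sum_apply, map_neg, map_smul,
        map_sum]
      congr 2
      refine Finset.sum_congr rfl fun j _ => ?_
      have := heis_comm β i j n (k + 1) v
      push_cast at this
      exact congrArg _ this

/-! ### The contravariant form on Fock space -/

/-- The square norm of the variable `X (i, k)`. -/
def normX {l : ℕ} (q : ℂ) (s : Fin l × ℕ) : ℂ := -(q ^ (-(s.2 : ℤ) - 1)) * ((s.2 : ℂ) + 1)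

/-- The square norm of a Fock monomial. -/
def normMonomial {l : ℕ} (q : ℂ) (d : Fin l × ℕ →₀ ℕ) : ℂ :=
  d.prod fun s n => normX q s ^ n * (n.factorial : ℂ)

/-- The bilinear form on Fock space for which monomials are orthogonal and the adjoint of `a^i(m)`
is `-q^m a^i(-m)`. -/
def fockForm {l : ℕ} (q : ℂ) : LinearMap.BilinForm ℂ (Fock l) :=
  (basisMonomials (Fin l × ℕ) ℂ).constr ℂ fun d => normMonomial q d • lcoeff ℂ d

theorem fockForm_monomial {l : ℕ} (q : ℂ) (d : Fin l × ℕ →₀ ℕ) (a : ℂ) (w : Fock l) :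
    fockForm q (monomial d a) w = a * normMonomial q d * coeff d w := by
  have h := (basisMonomials (Fin l × ℕ) ℂ).constr_basis ℂ
    (fun d => normMonomial q d • (lcoeff ℂ d : Fock l →ₗ[ℂ] ℂ)) d
  rw [coe_basisMonomials] at h
  have h2 : (monomial d a : Fock l) = a • monomial d 1 := by rw [smul_monomial]; simp
  rw [h2, map_smul, fockForm, h]
  simp [lcoeff, mul_assoc]

theorem fockForm_one {l : ℕ} (q : ℂ) : fockForm q (1 : Fock l) 1 = 1 := by
  have := fockForm_monomial q (0 : Fin l × ℕ →₀ ℕ) 1 1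
  simpa [normMonomial] using this

theorem normX_ne_zero {l : ℕ} {q : ℂ} (hq : q ≠ 0) (s : Fin l × ℕ) : normX q s ≠ 0 :=
  mul_ne_zero (neg_ne_zero.mpr (zpow_ne_zero _ hq)) (Nat.cast_add_one_ne_zero _)

theorem normMonomial_ne_zero {l : ℕ} {q : ℂ} (hq : q ≠ 0) (d : Fin l × ℕ →₀ ℕ) :
    normMonomial q d ≠ 0 :=
  Finset.prod_ne_zero_iff.mpr fun s _ =>
    mul_ne_zero (pow_ne_zero _ (normX_ne_zero hq s)) (Nat.cast_ne_zero.mpr (Nat.factorial_ne_zero _))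

theorem fockForm_comm {l : ℕ} (q : ℂ) (v w : Fock l) : fockForm q v w = fockForm q w v := by
  induction v using MvPolynomial.induction_on' with
  | add v v' h h' => rw [map_add, LinearMap.add_apply, map_add, h, h']
  | monomial d a =>
    induction w using MvPolynomial.induction_on' with
    | add w w' h h' => rw [map_add, map_add, LinearMap.add_apply, h, h']
    | monomial e b =>
      classical
      rw [fockForm_monomial, fockForm_monomial, coeff_monomial, coeff_monomial]
      by_cases h : d = e
      · subst h; simp; ring
      · rw [if_neg (Ne.symm h), if_neg h]; simp

theorem normMonomial_single_add {l : ℕ} (q : ℂ) (s : Fin l × ℕ) (d : Fin l × ℕ →₀ ℕ) :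
    normMonomial q (Finsupp.single s 1 + d) = normX q s * ((d s : ℂ) + 1) * normMonomial q d := by
  classical
  set g : Fin l × ℕ → ℕ → ℂ := fun s n => normX q s ^ n * (n.factorial : ℂ) with hg
  have hg0 : ∀ s, g s 0 = 1 := fun s => by simp [hg]
  have key : ∀ e : Fin l × ℕ →₀ ℕ, e.prod g = g s (e s) * (e.erase s).prod g := by
    intro e
    by_cases h : s ∈ e.support
    · exact (Finsupp.mul_prod_erase e s g h).symm
    · rw [Finsupp.erase_of_notMem_support h, Finsupp.notMem_support_iff.mp h, hg0, one_mul]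
  have herase : (Finsupp.single s 1 + d).erase s = d.erase s := by
    rw [Finsupp.erase_add, Finsupp.erase_single, zero_add]
  rw [normMonomial, normMonomial, key, key d, herase]
  simp only [Finsupp.coe_add, Pi.add_apply, Finsupp.single_eq_same, hg]
  rw [add_comm 1 (d s), pow_succ, Nat.factorial_succ]
  push_cast
  ring

/-- Raising the exponent at s from d s to d s + 1 multiplies the norm of a monomial by `normX q s`
and by d s + 1; the latter is the factor produced by differentiation. -/
theorem fockForm_X_mul {l : ℕ} (q : ℂ) (s : Fin l × ℕ) (v w : Fock l) :
    fockForm q (X s * v) w = normX q s * fockForm q v (pderiv s w) := by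
  induction v using MvPolynomial.induction_on' with
  | add v v' h h' => rw [mul_add, map_add, LinearMap.add_apply, h, h', map_add, LinearMap.add_apply,
      mul_add]
  | monomial d a =>
    rw [X, monomial_mul, one_mul, fockForm_monomial, fockForm_monomial, coeff_pderiv,
      normMonomial_single_add, add_comm d]
    ring

/-- The momentum is negated because a^i(0) must be anti-self-adjoint (the case m = 0); this is why
M_β can only pair with M_{-β}. -/
theorem fockForm_heis {l : ℕ} {q : ℂ} (hq : q ≠ 0) (β : Fin l → ℂ) (i : Fin l) (m : ℤ)
    (v w : Fock l) :
    fockForm q (heis β i m v) w = -(q ^ m) * fockForm q v (heis (-β) i (-m) w) := by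
  have key : ∀ (k : ℕ) (v w : Fock l), fockForm q (X (i, k) * v) w =
      -(q ^ (-((k : ℤ) + 1))) * fockForm q v (((k : ℂ) + 1) • pderiv (i, k) w) := by
    intro k v w
    rw [fockForm_X_mul, normX, map_smul, smul_eq_mul, neg_add']
    ring
  obtain rfl | ⟨k, rfl⟩ | ⟨k, rfl⟩ : m = 0 ∨ (∃ k : ℕ, m = (k : ℤ) + 1) ∨
      ∃ k : ℕ, m = -((k : ℤ) + 1) := by
    rcases m with (_ | k) | k
    · exact Or.inl rfl
    · exact Or.inr (Or.inl ⟨k, rfl⟩)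
    · exact Or.inr (Or.inr ⟨k, by omega⟩)
  · simp [heis_zero]
  · rw [fockForm_comm q v, heis_negSucc, key, fockForm_comm, ← mul_assoc, neg_mul_neg,
      ← zpow_add₀ hq, heis_add_one]
    simp
  · rw [heis_negSucc, key, neg_neg, heis_add_one]
    simp

theorem fockForm_nondegenerate {l : ℕ} {q : ℂ} (hq : q ≠ 0) (v : Fock l)
    (h : ∀ w, fockForm q w v = 0) : v = 0 := by
  ext d
  have := h (monomial d 1)
  rw [fockForm_monomial, one_mul] at this
  simpa [normMonomial_ne_zero hq] using this

/-- `Y_-(α,z)` and `Y_+(α,z)` are adjoint to each other. -/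
theorem fockForm_Yminus {l : ℕ} {q : ℂ} (hq : q ≠ 0) (α : Fin l → ℂ) (m : ℕ) (v w : Fock l) :
    fockForm q (PowerSeries.coeff m (Yminus α) * v) w =
      q ^ (-(m : ℤ)) * fockForm q v (PowerSeries.coeff m (Yplus α) w) := by
  revert v w
  refine coeff_expSeries_rel (P := fun m (x : Fock l) (y : Module.End ℂ (Fock l)) =>
    ∀ v w, fockForm q (x * v) w = q ^ (-(m : ℤ)) * fockForm q v (y w))
    (by simp) (by simp) ?_ ?_ ?_ (fun m => ?_) m
  · intro m x y x' y' hx hy v w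
    simp [add_mul, hx, hy, mul_add]
  · intro m r x x' hx v w
    rw [smul_mul_assoc, map_smul, LinearMap.smul_apply, hx, LinearMap.smul_apply, map_smul]
    simp only [smul_eq_mul]
    ring
  · intro m n x y x' y' hx hy v w
    rw [mul_assoc, hx, hy, Module.End.mul_apply, ← mul_assoc, ← zpow_add₀ hq]
    congr 2
    push_cast
    ring
  · intro v w
    rw [PowerSeries.coeff_mk, PowerSeries.coeff_mk]
    cases m with
    | zero => simp
    | succ k =>
      simp only [smul_mul_assoc, Finset.sum_mul, map_smul, map_sum, LinearMap.smul_apply,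
        LinearMap.sum_apply, LinearMap.neg_apply, map_neg]
      simp only [← heis_negSucc 0, fockForm_heis hq, neg_neg, neg_zero, smul_eq_mul]
      push_cast
      rw [mul_neg, ← neg_mul, mul_left_comm, Finset.mul_sum (a := -q ^ _)]
      congr 1
      exact Finset.sum_congr rfl fun i _ => by ring

/-! ### Coefficients of fields -/

theorem sum_Icc_neg {M : Type*} [AddCommMonoid M] (n : ℕ) (f : ℤ → M) :
    ∑ m ∈ Finset.Icc (-(n : ℤ)) n, f m =
      ∑ p ∈ Finset.range n, f (Int.negSucc p) + ∑ p ∈ Finset.range (n + 1), f p := by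
  induction n with
  | zero => simp
  | succ n ih =>
    have h : Finset.Icc (-((n + 1 : ℕ) : ℤ)) ((n + 1 : ℕ) : ℤ) =
        insert (Int.negSucc n) (insert ((n + 1 : ℕ) : ℤ) (Finset.Icc (-(n : ℤ)) n)) := by
      ext m
      simp only [Finset.mem_Icc, Finset.mem_insert]
      omega
    rw [h, Finset.sum_insert, Finset.sum_insert, ih, Finset.sum_range_succ (fun p => f (Int.negSucc p)) n,
      Finset.sum_range_succ (fun p : ℕ => f p) (n + 1)]
    · abel
    · simp
    · simp only [Finset.mem_Icc, Finset.mem_insert]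
      omega

/-- Boundedness below of f makes the convolution finite. The cutoff is stated as "all sufficiently
large M" so that several such expansions can later share one M. -/
theorem ofPowerSeries_mul_coeff {R : Type*} [CommRing R] (P : PowerSeries R) (f : HahnSeries ℤ R)
    (n : ℤ) : ∀ᶠ M : ℕ in atTop, (HahnSeries.ofPowerSeries ℤ R P * f).coeff n =
      ∑ j ∈ Finset.range M, PowerSeries.coeff j P * f.coeff (n - j) := by
  have key : ∀ a, (HahnSeries.ofPowerSeries ℤ R P).coeff a ≠ 0 → 0 ≤ a := by
    intro a ha
    rw [HahnSeries.ofPowerSeries_apply] at ha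
    by_contra hneg
    refine ha (HahnSeries.embDomain_of_notMem_range ?_)
    rintro ⟨x, hx⟩
    simp at hx
    omega
  filter_upwards [eventually_ge_atTop (n - f.order + 1).toNat] with M hM
  rw [HahnSeries.coeff_mul]
  refine Finset.sum_bij_ne_zero (fun ij _ _ => ij.1.toNat) ?_ ?_ ?_ ?_
  · rintro ⟨a, b⟩ h _
    rw [Finset.mem_antidiagonal] at h
    have hb := HahnSeries.order_le_of_coeff_ne_zero h.2.1
    have := h.2.2
    simp only [Finset.mem_range] at this hb ⊢
    have ha := key a h.1
    omega
  · rintro ⟨a, b⟩ h _ ⟨a', b'⟩ h' _ heq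
    rw [Finset.mem_antidiagonal] at h h'
    have h1 := key a h.1
    have h2 := key a' h'.1
    have h3 := h.2.2
    have h4 := h'.2.2
    simp only at heq h3 h4
    ext <;> simp only <;> omega
  · intro j _ hne
    refine ⟨((j : ℤ), n - j), ?_, ?_, by simp⟩
    · rw [Finset.mem_antidiagonal]
      refine ⟨?_, ?_, by simp⟩
      · change (HahnSeries.ofPowerSeries ℤ R P).coeff (j : ℤ) ≠ 0
        rw [HahnSeries.ofPowerSeries_apply_coeff]
        exact left_ne_zero_of_mul hne
      · exact right_ne_zero_of_mul hne
    · simpa only [HahnSeries.ofPowerSeries_apply_coeff] using hne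
  · rintro ⟨a, b⟩ h hne
    rw [Finset.mem_antidiagonal] at h
    obtain ⟨h1, h2, h3⟩ := h
    have ha : 0 ≤ a := key a h1
    obtain ⟨a, rfl⟩ := Int.eq_ofNat_of_zero_le ha
    simp only at h3
    simp only [Int.toNat_natCast, HahnSeries.ofPowerSeries_apply_coeff]
    rw [← h3, add_sub_cancel_left]

theorem hahn_mul_smul {l : ℕ} (r : ℂ) (f g : HahnSeries ℤ (Fock l)) :
    f * r • g = r • (f * g) := by
  have h : ∀ y : HahnSeries ℤ (Fock l), r • y = HahnSeries.C (MvPolynomial.C r) * y := fun y => by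
    rw [HahnSeries.C_mul_eq_smul]
    ext1
    funext n
    simp only [HahnSeries.coeff_smul, smul_eq_mul, MvPolynomial.smul_eq_C_mul]
  rw [h, h, mul_left_comm]

/-- Multiplication by a Laurent series. -/
def hahnMul {l : ℕ} (f : HahnSeries ℤ (Fock l)) :
    HahnSeries ℤ (Fock l) →ₗ[ℂ] HahnSeries ℤ (Fock l) where
  toFun g := f * g
  map_add' := mul_add f
  map_smul' r g := hahn_mul_smul r f g

theorem hahnMul_apply {l : ℕ} (f g : HahnSeries ℤ (Fock l)) : hahnMul f g = f * g := rfl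

/-- Multiplication of a Laurent series by `z^a`. -/
def zMul (l : ℕ) (a : ℤ) : HahnSeries ℤ (Fock l) →ₗ[ℂ] HahnSeries ℤ (Fock l) :=
  hahnMul (HahnSeries.single a 1)

@[simp]
theorem zMul_coeff {l : ℕ} (a : ℤ) (f : HahnSeries ℤ (Fock l)) (n : ℤ) :
    (zMul l a f).coeff n = f.coeff (n - a) := by
  simp [zMul, hahnMul_apply, HahnSeries.coeff_single_mul]

theorem creationPart_mul_coeff {l : ℕ} (i : Fin l) (k : ℕ) (f : HahnSeries ℤ (Fock l)) (n : ℤ) :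
    ∀ᶠ M : ℕ in atTop, (creationPart i k * f).coeff n =
      ∑ p ∈ Finset.range M, (p.choose k : ℂ) • (X (i, p) * f.coeff (n + k - p)) := by
  -- Multiplying by z^k indexes the terms by the variable X (i, p) itself; the terms added for p < k
  -- have binomial coefficient zero.
  have h : HahnSeries.ofPowerSeries ℤ (Fock l)
      (PowerSeries.mk fun p => (p.choose k : Fock l) * X (i, p)) =
      HahnSeries.single (k : ℤ) 1 * creationPart i k := by
    rw [creationPart, ← HahnSeries.ofPowerSeries_X_pow, ← map_mul]
    congr 1
    ext1 p
    rw [PowerSeries.coeff_mk, PowerSeries.coeff_X_pow_mul']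
    split_ifs with hp
    · rw [PowerSeries.coeff_mk, Nat.sub_add_cancel hp]
    · rw [Nat.choose_eq_zero_of_lt (by omega)]
      simp
  have h2 : (creationPart i k * f).coeff n = (HahnSeries.ofPowerSeries ℤ (Fock l)
      (PowerSeries.mk fun p => (p.choose k : Fock l) * X (i, p)) * f).coeff (n + k) := by
    rw [h, mul_assoc, HahnSeries.coeff_single_mul]
    simp
  rw [h2]
  filter_upwards [ofPowerSeries_mul_coeff (PowerSeries.mk fun p => (p.choose k : Fock l) * X (i, p))
    f (n + k)] with M hM
  rw [hM]
  refine Finset.sum_congr rfl fun p _ => ?_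
  rw [PowerSeries.coeff_mk, mul_assoc, Nat.cast_smul_eq_nsmul, nsmul_eq_mul]

/-- The coefficient of `z^n` in the normally ordered product `:a^i(m) V(z): v`. -/
def nordCoeff {l : ℕ} (β : Fin l → ℂ) (i : Fin l) (V : Fld l) (v : Fock l) : ℤ → ℤ → Fock l
  | Int.ofNat p, n => (V (heis β i p v)).coeff n
  | Int.negSucc p, n => X (i, p) * (V v).coeff n

/-- The expansion ∂^k a^i(z)/k! = ∑_m C(-m-1, k) a^i(m) z^{-m-1-k} treats creation and annihilation
modes uniformly; the coefficient vanishes for -k ≤ m < 0. The window is symmetric because adjoints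
exchange m and -m. -/
theorem normalMul_coeff_eventually {l : ℕ} (β : Fin l → ℂ) (i : Fin l) (k : ℕ) (V : Fld l)
    (v : Fock l) (n : ℤ) : ∀ᶠ M : ℕ in atTop, (normalMul β (i, k) V v).coeff n =
      ∑ m ∈ Finset.Icc (-(M : ℤ)) M,
        ((Ring.choose (-m - 1) k : ℤ) : ℂ) • nordCoeff β i V v m (n + m + 1 + k) := by
  filter_upwards [creationPart_mul_coeff i k (V v) n, heis_eventually_zero β i v] with M h1 h2
  change (creationPart i k * V v + ∑ᶠ n : ℕ, annTerm β i k V v n).coeff n = _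
  rw [annTerm_finsum β i k V v (M + 1) (fun m hm => h2 m (by omega)), HahnSeries.coeff_add, h1,
    sum_Icc_neg, HahnSeries.coeff_sum]
  congr 1
  · refine Finset.sum_congr rfl fun p _ => ?_
    rw [show -Int.negSucc p - 1 = (p : ℤ) by omega, Ring.choose_natCast]
    simp only [nordCoeff, Int.cast_natCast]
    congr 3
    omega
  · refine Finset.sum_congr rfl fun p _ => ?_
    rw [annTerm, HahnSeries.coeff_single_mul]
    change _ = _ • (V (heis β i p v)).coeff _
    rw [Int.cast_smul_eq_zsmul, zsmul_eq_mul]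
    congr 2
    ring

/-- Normally ordered multiplication commutes with multiplication by a Laurent series. -/
theorem normalMul_hahnMul {l : ℕ} (β : Fin l → ℂ) (s : Fin l × ℕ) (f : HahnSeries ℤ (Fock l))
    (V : Fld l) : normalMul β s (hahnMul f ∘ₗ V) =
      hahnMul f ∘ₗ normalMul β s V := by
  refine LinearMap.ext fun w => ?_
  obtain ⟨K, hK⟩ := heis_eq_zero β s.1 w
  change creationPart s.1 s.2 * (f * V w) + ∑ᶠ n : ℕ, annTerm β s.1 s.2 _ w n =
    f * (creationPart s.1 s.2 * V w + ∑ᶠ n : ℕ, annTerm β s.1 s.2 V w n)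
  have hann : ∀ n, annTerm β s.1 s.2 (hahnMul f ∘ₗ V) w n = f * annTerm β s.1 s.2 V w n :=
    fun n => mul_left_comm _ f _
  rw [annTerm_finsum β s.1 s.2 _ w K hK, annTerm_finsum β s.1 s.2 V w K hK, mul_add,
    mul_left_comm (creationPart s.1 s.2) f (V w), Finset.mul_sum]
  exact congrArg _ (Finset.sum_congr rfl fun n _ => hann n)

theorem normalMul_zMul {l : ℕ} (β : Fin l → ℂ) (s : Fin l × ℕ) (a : ℤ) (V : Fld l) :
    normalMul β s (zMul l a ∘ₗ V) = zMul l a ∘ₗ normalMul β s V :=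
  normalMul_hahnMul β s _ V

/-- Normally ordered multiplication is linear in the field. -/
def normalMulHom {l : ℕ} (β : Fin l → ℂ) (s : Fin l × ℕ) : Fld l →ₗ[ℂ] Fld l where
  toFun := normalMul β s
  map_add' V V' := by
    refine LinearMap.ext fun w => ?_
    obtain ⟨K, hK⟩ := heis_eq_zero β s.1 w
    change creationPart s.1 s.2 * (V w + V' w) + ∑ᶠ n : ℕ, annTerm β s.1 s.2 _ w n =
      creationPart s.1 s.2 * V w + ∑ᶠ n : ℕ, annTerm β s.1 s.2 V w n +
      (creationPart s.1 s.2 * V' w + ∑ᶠ n : ℕ, annTerm β s.1 s.2 V' w n)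
    rw [annTerm_finsum β s.1 s.2 _ w K hK, annTerm_finsum β s.1 s.2 _ w K hK,
      annTerm_finsum β s.1 s.2 _ w K hK]
    simp only [annTerm, LinearMap.add_apply, mul_add, Finset.sum_add_distrib]
    abel
  map_smul' r V := by
    refine LinearMap.ext fun w => ?_
    obtain ⟨K, hK⟩ := heis_eq_zero β s.1 w
    change creationPart s.1 s.2 * (r • V w) + ∑ᶠ n : ℕ, annTerm β s.1 s.2 _ w n =
      r • (creationPart s.1 s.2 * V w + ∑ᶠ n : ℕ, annTerm β s.1 s.2 V w n)
    rw [annTerm_finsum β s.1 s.2 _ w K hK, annTerm_finsum β s.1 s.2 _ w K hK]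
    simp only [annTerm, LinearMap.smul_apply, hahn_mul_smul, smul_add, Finset.smul_sum]

theorem normalMulHom_apply {l : ℕ} (β : Fin l → ℂ) (s : Fin l × ℕ) (V : Fld l) :
    normalMulHom β s V = normalMul β s V := rfl

/-- The dependence of the normally ordered product on the momentum. -/
theorem normalMul_add_momentum {l : ℕ} (α γ : Fin l → ℂ) (i : Fin l) (k : ℕ) (V : Fld l) :
    normalMul (γ + α) (i, k) V = normalMul γ (i, k) V +
      ((-1) ^ k * α i) • (zMul l (-1 - k) ∘ₗ V) := by
  refine LinearMap.ext fun w => ?_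
  ext1
  funext n
  -- Only the zero mode sees the momentum, and its coefficient in ∂^k a^i(z)/k! is C(-1, k) z^{-1-k}
  -- = (-1)^k z^{-1-k}.
  have hnord : ∀ m N, nordCoeff (γ + α) i V w m N = nordCoeff γ i V w m N +
      if m = 0 then α i • (V w).coeff N else 0 := by
    intro m N
    rcases m with (_ | p) | p
    · change (V ((γ + α) i • w)).coeff N = (V (γ i • w)).coeff N + _
      simp [add_smul]
    · simp only [nordCoeff]
      rw [if_neg (by simp; omega), add_zero]
      rfl
    · simp [nordCoeff]
  obtain ⟨M, h1, h2⟩ := ((normalMul_coeff_eventually (γ + α) i k V w n).and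
    (normalMul_coeff_eventually γ i k V w n)).exists
  have hch : Ring.choose (-1 : ℤ) k = (-1) ^ k := by
    rw [Ring.choose_neg', Ring.multichoose_one, Int.negOnePow_def]
    simp [Units.smul_def]
  rw [LinearMap.add_apply, HahnSeries.coeff_add, h1, h2]
  simp only [hnord, smul_add, Finset.sum_add_distrib]
  congr 1
  rw [Finset.sum_eq_single (0 : ℤ)]
  · simp only [neg_zero, zero_sub, hch, if_true, smul_smul, LinearMap.smul_apply,
      LinearMap.comp_apply, HahnSeries.coeff_smul, zMul_coeff]
    push_cast
    congr 2
    ring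
  · intro m _ hm
    simp [hm]
  · intro h
    simp at h

/-! ### Adjoint fields -/

/-- `W(-t/z)`, for `q = -t`, is the adjoint of `V(z)`. -/
def FieldAdjoint {l : ℕ} (q : ℂ) (V W : Fld l) : Prop :=
  ∀ v w n, fockForm q ((V v).coeff n) w = q ^ (-n) * fockForm q v ((W w).coeff (-n))

/-- Taking adjoints reverses the order of a^i(m) and V while exchanging creation with annihilation,
so that normal order is preserved. For m = 0 the mode is a scalar and its position does not matter.
-/
theorem FieldAdjoint.nordCoeff {l : ℕ} {q : ℂ} (hq : q ≠ 0) {V W : Fld l}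
    (h : FieldAdjoint q V W) (β : Fin l → ℂ) (i : Fin l) (v w : Fock l) (m n : ℤ) :
    fockForm q (nordCoeff β i V v m n) w =
      -(q ^ (m - n)) * fockForm q v (HeisGVOA.nordCoeff (-β) i W w (-m) (-n)) := by
  rcases m with (_ | p) | p
  · change fockForm q ((V (β i • v)).coeff n) w =
      -(q ^ (0 - n)) * fockForm q v ((W ((-β) i • w)).coeff (-n))
    simp [h v w n]
    ring
  · change fockForm q ((V (heis β i ((p : ℤ) + 1) v)).coeff n) w =
      -(q ^ ((p : ℤ) + 1 - n)) * fockForm q v (X (i, p) * (W w).coeff (-n))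
    rw [h, fockForm_heis hq, heis_negSucc, ← mul_assoc, sub_eq_add_neg, zpow_add₀ hq _ (-n)]
    ring
  · change fockForm q (X (i, p) * (V v).coeff n) w =
      -(q ^ (Int.negSucc p - n)) * fockForm q v ((W (heis (-β) i ((p : ℤ) + 1) w)).coeff (-n))
    rw [← heis_negSucc β, fockForm_heis hq, h, ← mul_assoc, sub_eq_add_neg, zpow_add₀ hq _ (-n),
      neg_neg, show Int.negSucc p = -((p : ℤ) + 1) by omega]
    ring

/-- Upper negation gives (-1)^k C((-m-1) + (k+1), k), which Vandermonde expands. It rewrites the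
coefficients of ∂^k a^i at the inverted variable in terms of the derivatives ∂^j a^i with j ≤ k. -/
theorem choose_sub_one (m : ℤ) (k : ℕ) :
    Ring.choose (m - 1) k =
      (-1) ^ k * ∑ j ∈ Finset.range (k + 1), ((k + 1).choose (j + 1) : ℤ) * Ring.choose (-m - 1) j := by
  have h1 : Ring.choose (m - 1) k = (-1) ^ k * Ring.choose ((-m - 1) + ((k + 1 : ℕ) : ℤ)) k := by
    have := Ring.choose_neg (R := ℤ) (1 - m) k
    rw [neg_sub, Int.negOnePow_def] at this
    rw [this]
    simp [Units.smul_def]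
    congr 2
    ring
  rw [h1, Ring.add_choose_eq k (Commute.all _ _), Finset.Nat.sum_antidiagonal_eq_sum_range_succ_mk]
  congr 1
  refine Finset.sum_congr rfl fun j hj => ?_
  rw [Ring.choose_natCast, mul_comm]
  congr 2
  rw [← Nat.choose_symm_of_eq_add (n := k + 1) (a := j + 1) (b := k - j)]
  have := Finset.mem_range.mp hj
  omega

/-- The adjoint of a normally ordered product with a derivative of `a^i(z)`. -/
theorem FieldAdjoint.normalMul {l : ℕ} {q : ℂ} (hq : q ≠ 0) {V W : Fld l}
    (h : FieldAdjoint q V W) (β : Fin l → ℂ) (i : Fin l) (k : ℕ) :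
    FieldAdjoint q (normalMul β (i, k) V) ((-q) ^ (-1 - (k : ℤ)) •
      ∑ j ∈ Finset.range (k + 1), ((k + 1).choose (j + 1) : ℂ) •
        (zMul l (k + j + 2) ∘ₗ HeisGVOA.normalMul (-β) (i, j) W)) := by
  intro v w n
  obtain ⟨M, h1, h2⟩ := ((normalMul_coeff_eventually β i k V v n).and
    ((eventually_all_finset (Finset.range (k + 1))).mpr fun j _ =>
      normalMul_coeff_eventually (-β) i j W w (-n - (k + j + 2)))).exists
  simp only [LinearMap.smul_apply, LinearMap.sum_apply, HahnSeries.coeff_smul,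
    HahnSeries.coeff_sum, LinearMap.comp_apply, zMul_coeff, map_smul, map_sum, smul_eq_mul]
  rw [h1]
  simp only [map_sum, map_smul, LinearMap.sum_apply, LinearMap.smul_apply, smul_eq_mul,
    h.nordCoeff hq]
  -- The adjoint of the mode m is a multiple of the mode -m, so one of the two sums has to be
  -- reflected.
  have hneg : ∀ f : ℤ → ℂ, ∑ m ∈ Finset.Icc (-(M : ℤ)) M, f m =
      ∑ m ∈ Finset.Icc (-(M : ℤ)) M, f (-m) := by
    intro f
    refine Finset.sum_nbij' (fun m => -m) (fun m => -m) ?_ ?_ ?_ ?_ ?_ <;>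
      simp only [Finset.mem_Icc] <;> intros <;> first | omega | simp
  rw [hneg]
  have hR : ∀ j ∈ Finset.range (k + 1),
      ((k + 1).choose (j + 1) : ℂ) * fockForm q v
        ((HeisGVOA.normalMul (-β) (i, j) W w).coeff (-n - (k + j + 2))) =
      ∑ m ∈ Finset.Icc (-(M : ℤ)) M, ((k + 1).choose (j + 1) : ℂ) *
        (((Ring.choose (-m - 1) j : ℤ) : ℂ) *
          fockForm q v (HeisGVOA.nordCoeff (-β) i W w m (-n + m - 1 - k))) := by
    intro j hj
    rw [h2 j hj, map_sum, Finset.mul_sum]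
    refine Finset.sum_congr rfl fun m _ => ?_
    rw [map_smul, smul_eq_mul]
    congr 4
    ring
  rw [Finset.sum_congr rfl hR, Finset.sum_comm, Finset.mul_sum, Finset.mul_sum]
  refine Finset.sum_congr rfl fun m _ => ?_
  rw [neg_neg, choose_sub_one m k]
  have hpow : q ^ (-m - (n + -m + 1 + (k : ℤ))) = q ^ (-n) * q ^ (-1 - (k : ℤ)) := by
    rw [← zpow_add₀ hq]
    congr 1
    ring
  -- The sign (-1)^k of the Vandermonde identity and the minus sign in the adjoint of a^i(m)
  -- together turn a power of q into a power of -q.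
  have hsign : (-q) ^ (-1 - (k : ℤ)) = -((-1) ^ k * q ^ (-1 - (k : ℤ))) := by
    rw [← neg_one_mul, mul_zpow, show (-1 - (k : ℤ)) = -((k + 1 : ℕ) : ℤ) by push_cast; ring,
      zpow_neg, zpow_natCast, pow_succ]
    rcases neg_one_pow_eq_or ℂ k with h | h <;> simp [h]
  have harg : -(n + -m + 1 + (k : ℤ)) = -n + m - 1 - k := by ring
  rw [hpow, hsign, harg]
  push_cast
  simp only [← mul_assoc, ← Finset.sum_mul]
  ring

/-! ### The vertex operators as fields -/

theorem exponent_induction {σ : Type*} {P : (σ →₀ ℕ) → Prop} (h0 : P 0)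
    (h : ∀ s d, P d → P (Finsupp.single s 1 + d)) (d : σ →₀ ℕ) : P d := by
  classical
  rw [← Finsupp.toMultiset_toFinsupp d]
  induction Finsupp.toMultiset d using Multiset.induction_on with
  | empty => simpa using h0
  | cons s m ih =>
    rw [← Multiset.singleton_add, map_add, Multiset.toFinsupp_singleton]
    exact h s _ ih

theorem X_mul_monomial {l : ℕ} (s : Fin l × ℕ) (d : Fin l × ℕ →₀ ℕ) (a : ℂ) :
    X s * monomial d a = monomial (Finsupp.single s 1 + d) a := by
  rw [X, monomial_mul, one_mul]

theorem heisY_one {l : ℕ} (β : Fin l → ℂ) :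
    heisY β (1 : Fock l) = HahnSeries.single.linearMap 0 := by
  simpa using heisY_monomial β (0 : Fin l × ℕ →₀ ℕ)

theorem heisY_X_mul {l : ℕ} (β : Fin l → ℂ) (s : Fin l × ℕ) (u : Fock l) :
    heisY β (X s * u) = normalMul β s (heisY β u) := by
  rw [← normalMulHom_apply]
  induction u using MvPolynomial.induction_on' with
  | add u u' h h' => rw [mul_add, map_add, h, h', map_add, map_add]
  | monomial d a =>
    have h2 : ∀ d : Fin l × ℕ →₀ ℕ, (monomial d a : Fock l) = a • monomial d 1 := fun d => by
      rw [smul_monomial]; simp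
    rw [X_mul_monomial, h2, h2 d, map_smul, map_smul, map_smul, heisY_monomial, heisY_monomial,
      map_add, Finsupp.toMultiset_single, one_smul, Multiset.singleton_add, Multiset.foldr_cons,
      normalMulHom_apply]

theorem coreSeries_eventually {l : ℕ} (α β : Fin l → ℂ) (v : Fock l) :
    ∀ᶠ M : ℕ in atTop, ∀ u, coreSeries α β u v = HahnSeries.ofPowerSeries ℤ (Fock l) (Yminus α) *
      ∑ m ∈ Finset.range M, HahnSeries.single (-(m : ℤ)) (1 : Fock l) *
        heisY β u (PowerSeries.coeff m (Yplus α) v) := by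
  filter_upwards [Yplus_eventually_zero α v] with M hM u
  rw [coreSeries, finsum_eq_sum_of_support_subset]
  intro m hm
  simp only [Finset.coe_range, Set.mem_Iio]
  by_contra h
  exact hm (by simp [hM m (not_lt.mp h)])

/-- `Y_-(α,z) Y(u,z) Y_+(α,z)` on `M_β`, as a field depending linearly on `u`. -/
def coreField {l : ℕ} (α β : Fin l → ℂ) : Fock l →ₗ[ℂ] Fld l :=
  LinearMap.mk₂ ℂ (coreSeries α β)
    (fun u u' v => by
      obtain ⟨M, hM⟩ := (coreSeries_eventually α β v).exists
      simp only [hM, map_add, LinearMap.add_apply, mul_add, Finset.sum_add_distrib])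
    (fun r u v => by
      obtain ⟨M, hM⟩ := (coreSeries_eventually α β v).exists
      simp only [hM, map_smul, LinearMap.smul_apply, hahn_mul_smul, ← Finset.smul_sum])
    (fun u v v' => by
      obtain ⟨M, h, h1, h2⟩ := ((coreSeries_eventually α β v).and
        ((coreSeries_eventually α β v').and (coreSeries_eventually α β (v + v')))).exists
      simp only [h, h1, h2, map_add, mul_add, Finset.sum_add_distrib])
    (fun r u v => by
      obtain ⟨M, h, h1⟩ := ((coreSeries_eventually α β v).and
        (coreSeries_eventually α β (r • v))).exists
      simp only [h, h1, map_smul, hahn_mul_smul, ← Finset.smul_sum])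

theorem coreField_apply {l : ℕ} (α β : Fin l → ℂ) (u v : Fock l) :
    coreField α β u v = coreSeries α β u v := rfl

/-- Creation operators commute with Y_- and nonnegative modes with Y_+, so a normally ordered factor
inside Y(u,z) can be pulled out of the whole product. The momentum is that of the source M_β, since
e^α stands to the left of everything. -/
theorem coreField_X_mul {l : ℕ} (α β : Fin l → ℂ) (s : Fin l × ℕ) (u : Fock l) :
    coreField α β (X s * u) = normalMul β s (coreField α β u) := by
  refine LinearMap.ext fun v => ?_
  obtain ⟨K, hK⟩ := heis_eq_zero β s.1 v
  obtain ⟨M, h, h1⟩ := ((coreSeries_eventually α β v).and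
    ((eventually_all_finset (Finset.range K)).mpr fun n _ =>
      coreSeries_eventually α β (heis β s.1 n v))).exists
  have hY : ∀ m, heisY β (X s * u) (PowerSeries.coeff m (Yplus α) v) =
      creationPart s.1 s.2 * heisY β u (PowerSeries.coeff m (Yplus α) v) +
      ∑ n ∈ Finset.range K, annTerm β s.1 s.2 (heisY β u) (PowerSeries.coeff m (Yplus α) v) n := by
    intro m
    rw [heisY_X_mul, ← annTerm_finsum β s.1 s.2 (heisY β u) _ K]
    · rfl
    · intro n hn
      rw [heis_Yplus_comm, hK n hn, map_zero]
  change coreSeries α β (X s * u) v = creationPart s.1 s.2 * coreSeries α β u v +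
    ∑ᶠ n : ℕ, annTerm β s.1 s.2 (coreField α β u) v n
  have hann : ∀ n ∈ Finset.range K, annTerm β s.1 s.2 (coreField α β u) v n =
      HahnSeries.ofPowerSeries ℤ (Fock l) (Yminus α) *
      ∑ m ∈ Finset.range M, HahnSeries.single (-(m : ℤ)) (1 : Fock l) *
        annTerm β s.1 s.2 (heisY β u) (PowerSeries.coeff m (Yplus α) v) n := by
    intro n hn
    rw [annTerm, coreField_apply, h1 n hn,
      mul_left_comm _ (HahnSeries.ofPowerSeries ℤ (Fock l) (Yminus α)) _, Finset.mul_sum]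
    refine congrArg _ (Finset.sum_congr rfl fun m _ => ?_)
    rw [annTerm, heis_Yplus_comm]
    exact mul_left_comm _ _ _
  rw [annTerm_finsum β s.1 s.2 _ v K hK, Finset.sum_congr rfl hann, h, h u, ← Finset.mul_sum,
    mul_left_comm (creationPart s.1 s.2) (HahnSeries.ofPowerSeries ℤ (Fock l) (Yminus α)) _,
    ← mul_add, Finset.sum_comm, Finset.mul_sum (a := creationPart s.1 s.2),
    ← Finset.sum_add_distrib]
  refine congrArg _ (Finset.sum_congr rfl fun m _ => ?_)
  rw [hY, mul_add, Finset.mul_sum]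
  exact congrArg (· + _) (mul_left_comm _ _ _)

/-- For u = 𝟏 the field is Y_- Y_+. Adjunction sends Y_-(α,z) to Y_+(α,q/z) and conversely, and
reverses the order, so the product reproduces itself. Both momenta are free because neither factor
involves zero modes. -/
theorem fieldAdjoint_coreField_one {l : ℕ} {q : ℂ} (hq : q ≠ 0) (α β γ : Fin l → ℂ) :
    FieldAdjoint q (coreField α β 1) (coreField α γ 1) := by
  have key : ∀ (β : Fin l → ℂ) (v : Fock l) (n : ℤ), ∀ᶠ M : ℕ in atTop,
      (coreField α β 1 v).coeff n = ∑ a ∈ Finset.range M, ∑ m ∈ Finset.range M,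
        if n - a = -(m : ℤ) then
          PowerSeries.coeff a (Yminus α) * PowerSeries.coeff m (Yplus α) v else 0 := by
    intro β v n
    obtain ⟨M₀, h₀, h₁⟩ := ((coreSeries_eventually α β v).and (Yplus_eventually_zero α v)).exists
    set f := ∑ m ∈ Finset.range M₀, HahnSeries.single (-(m : ℤ)) (1 : Fock l) *
        heisY β 1 (PowerSeries.coeff m (Yplus α) v) with hf
    filter_upwards [ofPowerSeries_mul_coeff (Yminus α) f n, eventually_ge_atTop M₀] with M h1 h2
    rw [coreField_apply, h₀ 1, h1]
    refine Finset.sum_congr rfl fun a _ => ?_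
    have hfc : f.coeff (n - a) = ∑ m ∈ Finset.range M, if n - a = -(m : ℤ) then
        PowerSeries.coeff m (Yplus α) v else 0 := by
      rw [hf, HahnSeries.coeff_sum,
        ← Finset.sum_subset (Finset.range_mono h2) fun m _ hm => ?_]
      · refine Finset.sum_congr rfl fun m _ => ?_
        rw [heisY_one, HahnSeries.coeff_single_mul, one_mul]
        change (HahnSeries.single 0 _).coeff _ = _
        split_ifs with h
        · rw [h, sub_self, HahnSeries.coeff_single_same]
        · rw [HahnSeries.coeff_single_of_ne]
          omega
      · rw [h₁ m (by simpa using hm)]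
        simp
    rw [hfc, Finset.mul_sum]
    simp only [mul_ite, mul_zero]
  intro v w n
  obtain ⟨M, h1, h2⟩ := ((key β v n).and (key γ w (-n))).exists
  rw [h1, h2]
  simp only [map_sum, LinearMap.sum_apply]
  -- The summation indices of Y_- and Y_+ change roles under the adjunction.
  rw [Finset.sum_comm, Finset.mul_sum]
  refine Finset.sum_congr rfl fun a _ => ?_
  rw [Finset.mul_sum]
  refine Finset.sum_congr rfl fun m _ => ?_
  by_cases h : n - m = -(a : ℤ)
  · rw [if_pos h, if_pos (by omega), fockForm_Yminus hq, fockForm_comm,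
      fockForm_comm q v, fockForm_Yminus hq, ← mul_assoc (q ^ (-n)), ← zpow_add₀ hq]
    congr 2
    omega
  · rw [if_neg h, if_neg (by omega)]
    simp

/-! ### Divided powers of `L(1)` -/

/-- The operator `L(1)` on `M_α`: a derivation of the polynomial algebra. -/
def virOne {l : ℕ} (α : Fin l → ℂ) : Derivation ℂ (Fock l) (Fock l) :=
  mkDerivation ℂ fun s => match s with
    | (i, 0) => C (α i)
    | (i, k + 1) => ((k : ℂ) + 2) • X (i, k)

theorem virOne_X_zero {l : ℕ} (α : Fin l → ℂ) (i : Fin l) :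
    virOne α (X (i, 0)) = C (α i) := by
  rw [virOne, mkDerivation_X]

theorem virOne_X_succ {l : ℕ} (α : Fin l → ℂ) (i : Fin l) (k : ℕ) :
    virOne α (X (i, k + 1)) = ((k : ℂ) + 2) • X (i, k) := by
  rw [virOne, mkDerivation_X]

/-- The divided power `L(1)^j / j!` on `M_α`. -/
def virOneDiv {l : ℕ} (α : Fin l → ℂ) (j : ℕ) : Fock l →ₗ[ℂ] Fock l :=
  ((j.factorial : ℂ)⁻¹) • (virOne α).toLinearMap ^ j

theorem virOneDiv_zero {l : ℕ} (α : Fin l → ℂ) (u : Fock l) : virOneDiv α 0 u = u := by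
  simp [virOneDiv]

theorem virOneDiv_succ {l : ℕ} (α : Fin l → ℂ) (j : ℕ) (u : Fock l) :
    ((j : ℂ) + 1) • virOneDiv α (j + 1) u = virOneDiv α j (virOne α u) := by
  have hj : ((j : ℂ) + 1) ≠ 0 := Nat.cast_add_one_ne_zero j
  simp only [virOneDiv, LinearMap.smul_apply, pow_succ, Module.End.mul_apply, smul_smul]
  rw [Nat.factorial_succ]
  push_cast
  rw [mul_inv, ← mul_assoc, mul_inv_cancel₀ hj, one_mul]

theorem virOneDiv_succ' {l : ℕ} (α : Fin l → ℂ) (j : ℕ) (u : Fock l) :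
    ((j : ℂ) + 1) • virOneDiv α (j + 1) u = virOne α (virOneDiv α j u) := by
  have hj : ((j : ℂ) + 1) ≠ 0 := Nat.cast_add_one_ne_zero j
  simp only [virOneDiv, LinearMap.smul_apply, pow_succ', Module.End.mul_apply, smul_smul,
    Derivation.map_smul]
  rw [Nat.factorial_succ]
  push_cast
  rw [mul_inv, ← mul_assoc, mul_inv_cancel₀ hj, one_mul]

/-- The Leibniz rule for a derivation; dividing by factorials removes the binomial coefficients. -/
theorem virOneDiv_mul {l : ℕ} (α : Fin l → ℂ) (j : ℕ) (u v : Fock l) :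
    virOneDiv α j (u * v) =
      ∑ p ∈ Finset.HasAntidiagonal.antidiagonal j, virOneDiv α p.1 u * virOneDiv α p.2 v := by
  induction j with
  | zero => simp [virOneDiv_zero]
  | succ j ih =>
    have hj : ((j : ℂ) + 1) ≠ 0 := Nat.cast_add_one_ne_zero j
    refine smul_right_injective (Fock l) hj ?_
    change ((j : ℂ) + 1) • virOneDiv α (j + 1) (u * v) = ((j : ℂ) + 1) • _
    rw [virOneDiv_succ', ih, map_sum, Finset.smul_sum]
    have h1 : ∀ p ∈ Finset.HasAntidiagonal.antidiagonal (j + 1),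
        ((j : ℂ) + 1) • (virOneDiv α p.1 u * virOneDiv α p.2 v) =
        ((p.1 : ℂ) • virOneDiv α p.1 u) * virOneDiv α p.2 v +
          virOneDiv α p.1 u * ((p.2 : ℂ) • virOneDiv α p.2 v) := by
      intro p hp
      rw [Finset.HasAntidiagonal.mem_antidiagonal] at hp
      rw [smul_mul_assoc, mul_smul_comm, ← add_smul]
      congr 1
      exact_mod_cast hp.symm
    rw [Finset.sum_congr rfl h1, Finset.sum_add_distrib, Finset.Nat.sum_antidiagonal_succ,
      Finset.Nat.sum_antidiagonal_succ']
    simp only [Nat.cast_zero, zero_smul, zero_mul, mul_zero, zero_add, Nat.cast_add,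
      Nat.cast_one, virOneDiv_succ']
    rw [← Finset.sum_add_distrib]
    refine Finset.sum_congr rfl fun p _ => ?_
    rw [Derivation.leibniz, smul_eq_mul, smul_eq_mul]
    ring

/-- Each application of L(1) multiplies by the current mode number, giving (k+r+1)(k+r)⋯(k+2)/r!. -/
theorem virOneDiv_X_add {l : ℕ} (α : Fin l → ℂ) (i : Fin l) (r k : ℕ) :
    virOneDiv α r (X (i, k + r)) = ((k + r + 1).choose r : ℂ) • X (i, k) := by
  induction r with
  | zero => simp [virOneDiv_zero]
  | succ r ih =>
    have hr : ((r : ℂ) + 1) ≠ 0 := Nat.cast_add_one_ne_zero r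
    refine smul_right_injective (Fock l) hr ?_
    change ((r : ℂ) + 1) • _ = ((r : ℂ) + 1) • _
    rw [virOneDiv_succ, ← add_assoc, virOne_X_succ, map_smul, ih, smul_smul, smul_smul]
    congr 1
    have := Nat.add_one_mul_choose_eq (k + r + 1) r
    have h2 : ((k : ℂ) + r + 1 + 1) * ((k + r + 1).choose r : ℂ) =
        ((k + r + 1 + 1).choose (r + 1) : ℂ) * (r + 1) := by exact_mod_cast this
    push_cast
    linear_combination h2

/-- The mode numbers (k+1)k⋯2 multiply to (k+1)!, which the divided power cancels; the last
application turns a^i(-1) into the zero mode. -/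
theorem virOneDiv_succ_X {l : ℕ} (α : Fin l → ℂ) (i : Fin l) (k : ℕ) :
    virOneDiv α (k + 1) (X (i, k)) = C (α i) := by
  induction k with
  | zero =>
    have := virOneDiv_succ α 0 (X (i, 0))
    simpa [virOneDiv_zero, virOne_X_zero] using this
  | succ k ih =>
    have hr : (((k + 1 : ℕ) : ℂ) + 1) ≠ 0 := Nat.cast_add_one_ne_zero _
    refine smul_right_injective (Fock l) hr ?_
    change (((k + 1 : ℕ) : ℂ) + 1) • _ = (((k + 1 : ℕ) : ℂ) + 1) • _
    rw [virOneDiv_succ, virOne_X_succ, map_smul, ih]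
    congr 1
    push_cast
    ring

theorem virOneDiv_one {l : ℕ} (α : Fin l → ℂ) (j : ℕ) (hj : 0 < j) :
    virOneDiv α j (1 : Fock l) = 0 := by
  obtain ⟨j, rfl⟩ : ∃ j', j = j' + 1 := ⟨j - 1, by omega⟩
  have hr : ((j : ℂ) + 1) ≠ 0 := Nat.cast_add_one_ne_zero _
  refine smul_right_injective (Fock l) hr ?_
  change ((j : ℂ) + 1) • _ = ((j : ℂ) + 1) • _
  rw [virOneDiv_succ]
  simp

theorem virOneDiv_X_of_lt {l : ℕ} (α : Fin l → ℂ) (i : Fin l) (k r : ℕ) (h : k + 1 < r) :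
    virOneDiv α r (X (i, k)) = 0 := by
  induction k generalizing r with
  | zero =>
    obtain ⟨r, rfl⟩ : ∃ r', r = r' + 1 := ⟨r - 1, by omega⟩
    have hr : ((r : ℂ) + 1) ≠ 0 := Nat.cast_add_one_ne_zero _
    refine smul_right_injective (Fock l) hr ?_
    change ((r : ℂ) + 1) • _ = ((r : ℂ) + 1) • _
    rw [virOneDiv_succ, virOne_X_zero, ← mul_one (C (α i)), ← smul_eq_C_mul, map_smul,
      virOneDiv_one _ _ (by omega)]
    simp
  | succ k ih =>
    obtain ⟨r, rfl⟩ : ∃ r', r = r' + 1 := ⟨r - 1, by omega⟩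
    have hr : ((r : ℂ) + 1) ≠ 0 := Nat.cast_add_one_ne_zero _
    refine smul_right_injective (Fock l) hr ?_
    change ((r : ℂ) + 1) • _ = ((r : ℂ) + 1) • _
    rw [virOneDiv_succ, virOne_X_succ, map_smul, ih r (by omega)]
    simp

/-- L(1) lowers the weight by one. This justifies truncating e^{ζ^{-1} L(1)} u at the weight of u in
`adjointField`. -/
theorem virOneDiv_monomial_of_lt {l : ℕ} (α : Fin l → ℂ) (d : Fin l × ℕ →₀ ℕ) (j : ℕ)
    (h : fockWeight d < j) : virOneDiv α j (monomial d 1) = 0 := by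
  induction d using exponent_induction generalizing j with
  | h0 => exact virOneDiv_one α j (by omega)
  | h s d ih =>
    rw [fockWeight_add, fockWeight_single] at h
    rw [← X_mul_monomial, virOneDiv_mul]
    refine Finset.sum_eq_zero fun p hp => ?_
    rw [Finset.HasAntidiagonal.mem_antidiagonal] at hp
    by_cases h1 : s.2 + 1 < p.1
    · rw [virOneDiv_X_of_lt α s.1 s.2 p.1 h1, zero_mul]
    · rw [ih p.2 (by omega), mul_zero]

theorem sum_antidiagonal_eq_sum_range {M : Type*} [AddCommMonoid M] (a b : ℕ) (f : ℕ → ℕ → M)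
    (ha : ∀ r s, a < r → f r s = 0) (hb : ∀ r s, b < s → f r s = 0) :
    ∑ j ∈ Finset.range (a + b + 1), ∑ p ∈ Finset.HasAntidiagonal.antidiagonal j, f p.1 p.2 =
      ∑ r ∈ Finset.range (a + 1), ∑ s ∈ Finset.range (b + 1), f r s := by
  rw [← Finset.sum_product', Finset.sum_sigma']
  refine Finset.sum_bij_ne_zero (fun x _ _ => x.2) ?_ ?_ ?_ ?_
  · rintro ⟨j, r, s⟩ h hne
    simp only [Finset.mem_product, Finset.mem_range]
    constructor
    · by_contra hc
      exact hne (ha r s (by omega))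
    · by_contra hc
      exact hne (hb r s (by omega))
  · rintro ⟨j, r, s⟩ h _ ⟨j', r', s'⟩ h' _ heq
    simp only [Finset.mem_sigma, Finset.HasAntidiagonal.mem_antidiagonal] at h h'
    simp only [Prod.mk.injEq] at heq
    obtain ⟨rfl, rfl⟩ := heq
    obtain rfl : j = j' := by omega
    rfl
  · rintro ⟨r, s⟩ h hne
    simp only [Finset.mem_product, Finset.mem_range] at h
    exact ⟨⟨r + s, r, s⟩, by simp; omega, hne, rfl⟩
  · intros
    rfl

/-! ### The adjoint vertex operator -/

/-- The adjoint of `Y_-(α,z) Y(u,z) Y_+(α,z)`, for `u` of weight `n`, up to the substitution of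
`-t/z` for `z`, as a field on `M_γ`. -/
def adjointField {l : ℕ} (q : ℂ) (α γ : Fin l → ℂ) (n : ℕ) (u : Fock l) : Fld l :=
  (-q) ^ (-(n : ℤ)) • ∑ j ∈ Finset.range (n + 1),
    zMul l (2 * n - j) ∘ₗ coreField α γ (virOneDiv α j u)

theorem zMul_comp_zMul {l : ℕ} (a b : ℤ) (V : Fld l) :
    zMul l a ∘ₗ zMul l b ∘ₗ V = zMul l (a + b) ∘ₗ V := by
  refine LinearMap.ext fun v => ?_
  ext1
  funext n
  simp only [LinearMap.comp_apply, zMul_coeff]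
  congr 1
  ring

theorem zMul_comp_sum {l : ℕ} {ι : Type*} (a : ℤ) (s : Finset ι) (V : ι → Fld l) :
    zMul l a ∘ₗ (∑ j ∈ s, V j) = ∑ j ∈ s, zMul l a ∘ₗ V j := by
  refine LinearMap.ext fun v => ?_
  simp only [LinearMap.comp_apply, LinearMap.sum_apply, map_sum]

theorem alternating_sum_choose_succ (k : ℕ) :
    ∑ j ∈ Finset.range (k + 1), ((k + 1).choose (j + 1) : ℂ) * (-1) ^ j = 1 := by
  have h := Int.alternating_sum_range_choose_of_ne (n := k + 1) (by omega)
  rw [Finset.sum_range_succ'] at h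
  have h2 : (∑ j ∈ Finset.range (k + 1), (-1 : ℂ) ^ (j + 1) * ((k + 1).choose (j + 1) : ℂ)) +
      (-1) ^ 0 * ((k + 1).choose 0 : ℂ) = 0 := by exact_mod_cast h
  simp only [pow_zero, Nat.choose_zero_right, Nat.cast_one, mul_one] at h2
  have h3 : ∑ j ∈ Finset.range (k + 1), (-1 : ℂ) ^ (j + 1) * ((k + 1).choose (j + 1) : ℂ) =
      -∑ j ∈ Finset.range (k + 1), ((k + 1).choose (j + 1) : ℂ) * (-1) ^ j := by
    rw [← Finset.sum_neg_distrib]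
    exact Finset.sum_congr rfl fun j _ => by ring
  linear_combination h3 - h2

/-- The recursion matching `FieldAdjoint.normalMul`. On the left, Leibniz splits L(1)^{(r+s)} into r
applications to a^i(-k-1) and s to the monomial. The terms r = k - j ≤ k give the binomial
coefficients C(k+1, j+1) with momentum γ; the term r = k + 1 is α^i, which is the effect of
replacing γ by γ + α on the right. -/
theorem adjointField_X_mul {l : ℕ} {q : ℂ} (hq : q ≠ 0) (α γ : Fin l → ℂ) (i : Fin l) (k : ℕ)
    (d : Fin l × ℕ →₀ ℕ) :
    adjointField q α γ (k + 1 + fockWeight d) (X (i, k) * monomial d 1) =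
      (-q) ^ (-1 - (k : ℤ)) •
      ∑ j ∈ Finset.range (k + 1), ((k + 1).choose (j + 1) : ℂ) •
        (zMul l (k + j + 2) ∘ₗ normalMul (γ + α) (i, j)
          (adjointField q α γ (fockWeight d) (monomial d 1))) := by
  set n := fockWeight d with hn
  set u : Fock l := monomial d 1 with hu
  set W := adjointField q α γ n u with hW
  have hz : ∀ (a b : ℤ) (V : Fld l) (r : ℂ),
      zMul l a ∘ₗ (r • (zMul l b ∘ₗ V)) = r • (zMul l (a + b) ∘ₗ V) := fun a b V r => by
    rw [LinearMap.comp_smul, zMul_comp_zMul]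
  -- All momentum corrections carry the same power z^{k+1}, and their coefficients (-1)^j C(k+1,
  -- j+1) add up to 1.
  have hR : ∑ j ∈ Finset.range (k + 1), ((k + 1).choose (j + 1) : ℂ) •
        (zMul l (k + j + 2) ∘ₗ normalMul (γ + α) (i, j) W) =
      ∑ j ∈ Finset.range (k + 1), ((k + 1).choose (j + 1) : ℂ) •
        (zMul l (k + j + 2) ∘ₗ normalMul γ (i, j) W) + α i • (zMul l (k + 1) ∘ₗ W) := by
    have h1 : ∀ j ∈ Finset.range (k + 1), ((k + 1).choose (j + 1) : ℂ) •
        (zMul l (k + j + 2) ∘ₗ normalMul (γ + α) (i, j) W) =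
        ((k + 1).choose (j + 1) : ℂ) • (zMul l (k + j + 2) ∘ₗ normalMul γ (i, j) W) +
        (((k + 1).choose (j + 1) : ℂ) * (-1) ^ j) • (α i • (zMul l (k + 1) ∘ₗ W)) := by
      intro j _
      rw [normalMul_add_momentum, LinearMap.comp_add, hz, smul_add, smul_smul, smul_smul,
        mul_assoc, show ((k : ℤ) + j + 2 + (-1 - j)) = k + 1 by ring]
    rw [Finset.sum_congr rfl h1, Finset.sum_add_distrib, ← Finset.sum_smul,
      alternating_sum_choose_succ, one_smul]
  have hN : ∀ j, normalMul γ (i, j) W = (-q) ^ (-(n : ℤ)) • ∑ s ∈ Finset.range (n + 1),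
      zMul l (2 * n - s) ∘ₗ coreField α γ (X (i, j) * virOneDiv α s u) := by
    intro j
    rw [hW, adjointField, ← normalMulHom_apply, map_smul, map_sum]
    simp only [normalMulHom_apply, normalMul_zMul, coreField_X_mul]
  have hL : ∑ j ∈ Finset.range (k + 1 + n + 1),
      zMul l (2 * (k + 1 + n : ℕ) - j) ∘ₗ coreField α γ (virOneDiv α j (X (i, k) * u)) =
      ∑ r ∈ Finset.range (k + 1 + 1), ∑ s ∈ Finset.range (n + 1),
        zMul l (2 * (k + 1 + n : ℕ) - (r + s : ℕ)) ∘ₗ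
          coreField α γ (virOneDiv α r (X (i, k)) * virOneDiv α s u) := by
    rw [← sum_antidiagonal_eq_sum_range]
    · refine Finset.sum_congr rfl fun j _ => ?_
      rw [virOneDiv_mul, map_sum, zMul_comp_sum]
      refine Finset.sum_congr rfl fun p hp => ?_
      rw [Finset.HasAntidiagonal.mem_antidiagonal.mp hp]
    · intro r s hr
      rw [virOneDiv_X_of_lt α i k r hr]
      simp
    · intro r s hs
      rw [hu, virOneDiv_monomial_of_lt α d s hs]
      simp
  -- The term r = k + 1 is split off and the others are reversed, r = k - j.
  rw [adjointField, hL, hR, Finset.sum_range_succ, ← Finset.sum_range_reflect]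
  have hpow : (-q) ^ (-((k + 1 + n : ℕ) : ℤ)) = (-q) ^ (-1 - (k : ℤ)) * (-q) ^ (-(n : ℤ)) := by
    rw [← zpow_add₀ (neg_ne_zero.mpr hq)]
    congr 1
    push_cast
    ring
  rw [hpow, mul_smul]
  refine congrArg _ ?_
  rw [smul_add, Finset.smul_sum]
  refine congrArg₂ _ (Finset.sum_congr rfl fun j hj => ?_) ?_
  · have hjk : j ≤ k := by simpa [Nat.lt_succ_iff] using hj
    obtain ⟨r, rfl⟩ := Nat.exists_eq_add_of_le hjk
    rw [hN, LinearMap.comp_smul, smul_comm, zMul_comp_sum,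
      Finset.smul_sum (r := (((j + r + 1).choose (j + 1) : ℕ) : ℂ))]
    refine congrArg _ (Finset.sum_congr rfl fun s _ => ?_)
    rw [show j + r + 1 - 1 - j = r by omega, virOneDiv_X_add, smul_mul_assoc, map_smul,
      LinearMap.comp_smul, zMul_comp_zMul,
      Nat.choose_symm_of_eq_add (show j + r + 1 = r + (j + 1) by ring),
      show (2 * ((j + r + 1 + n : ℕ) : ℤ) - ((r + s : ℕ) : ℤ)) =
        ((j + r : ℕ) : ℤ) + j + 2 + (2 * n - s) by push_cast; ring]
  · rw [hW, adjointField, LinearMap.comp_smul, smul_comm, zMul_comp_sum,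
      Finset.smul_sum (r := α i)]
    refine congrArg _ (Finset.sum_congr rfl fun s _ => ?_)
    rw [virOneDiv_succ_X, ← smul_eq_C_mul, map_smul, LinearMap.comp_smul, zMul_comp_zMul,
      show (2 * ((k + 1 + n : ℕ) : ℤ) - ((k + 1 + s : ℕ) : ℤ)) =
        (k : ℤ) + 1 + (2 * n - s) by push_cast; ring]

/-- Induction on the creation operators in u. With γ = -(α + β) the momentum γ + α of the recursion
is -β, as the adjoint of a normally ordered product on M_β requires. -/
theorem fieldAdjoint_coreField {l : ℕ} {q : ℂ} (hq : q ≠ 0) (α β : Fin l → ℂ)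
    (d : Fin l × ℕ →₀ ℕ) :
    FieldAdjoint q (coreField α β (monomial d 1))
      (adjointField q α (-(α + β)) (fockWeight d) (monomial d 1)) := by
  induction d using exponent_induction with
  | h0 =>
    have h : adjointField q α (-(α + β)) (fockWeight (0 : Fin l × ℕ →₀ ℕ)) (monomial 0 1) =
        coreField α (-(α + β)) 1 := by
      have h0 : fockWeight (0 : Fin l × ℕ →₀ ℕ) = 0 := by simp [fockWeight]
      refine LinearMap.ext fun v => ?_
      ext1
      funext n
      simp [adjointField, h0, virOneDiv_zero]
    rw [h]
    exact fieldAdjoint_coreField_one hq _ _ _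
  | h s d ih =>
    obtain ⟨i, k⟩ := s
    rw [← X_mul_monomial, coreField_X_mul, fockWeight_add, fockWeight_single, one_mul,
      adjointField_X_mul hq, show -(α + β) + α = -β by abel]
    exact ih.normalMul hq β i k

/-! ### The operator `L(1)` -/

theorem normalMul_single_coeff {l : ℕ} (β : Fin l → ℂ) (i : Fin l) (v : Fock l) (n : ℤ) :
    (normalMul β (i, 0) (HahnSeries.single.linearMap 0) v).coeff n = heis β i (-n - 1) v := by
  obtain ⟨M, h1, h2⟩ := ((normalMul_coeff_eventually β i 0 (HahnSeries.single.linearMap 0) v n).and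
    (eventually_ge_atTop (-n - 1).natAbs)).exists
  have hn : ∀ m N, nordCoeff β i (HahnSeries.single.linearMap 0) v m N =
      if N = 0 then heis β i m v else 0 := by
    intro m N
    rcases m with p | p
    · change (HahnSeries.single 0 (heis β i p v)).coeff N = _
      split_ifs with h
      · rw [h, HahnSeries.coeff_single_same]; rfl
      · rw [HahnSeries.coeff_single_of_ne h]
    · change X (i, p) * (HahnSeries.single 0 v).coeff N = _
      split_ifs with h
      · rw [h, HahnSeries.coeff_single_same]; rfl
      · rw [HahnSeries.coeff_single_of_ne h, mul_zero]
  rw [h1, Finset.sum_eq_single (-n - 1)]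
  · rw [hn, if_pos (by push_cast; ring), Ring.choose_zero_right]
    simp
  · intro m _ hm
    rw [hn, if_neg (by push_cast; omega), smul_zero]
  · intro h
    exact absurd (Finset.mem_Icc.mpr ⟨by omega, by omega⟩) h

/-- The exponent -3 is -n-2 for n = 1. Each product of two modes with indices summing to 1 occurs
twice, once with either mode as the outer factor; hence the 2, which the 1/2 in ω cancels. -/
theorem heisY_sq_coeff {l : ℕ} (α : Fin l → ℂ) (i : Fin l) (u : Fock l) :
    ∀ᶠ M : ℕ in atTop, (heisY α (X (i, 0) ^ 2) u).coeff (-3) =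
      (2 : ℂ) • (α i • pderiv (i, 0) u +
        ∑ p ∈ Finset.range M, ((p : ℂ) + 2) • (X (i, p) * pderiv (i, p + 1) u)) := by
  have h1 := normalMul_coeff_eventually α i 0 (normalMul α (i, 0) (HahnSeries.single.linearMap 0)) u
    (-3)
  filter_upwards [(tendsto_add_atTop_nat 1).eventually h1, heis_eventually_zero α i u] with M h1 h2
  have hp : ∀ p : ℕ, heis α i ((p : ℤ) + 2) u = ((p : ℂ) + 2) • pderiv (i, p + 1) u := by
    intro p
    have := congrArg (fun T => T u) (heis_add_one α i (p + 1))
    push_cast at this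
    rw [show (p : ℤ) + 2 = p + 1 + 1 by ring, this, show (p : ℂ) + 2 = p + 1 + 1 by ring]
    rfl
  have hone : heis α i 1 u = pderiv (i, 0) u := by
    have := congrArg (fun T => T u) (heis_add_one α i 0)
    simpa using this
  rw [heisY_sq, h1, sum_Icc_neg]
  have hneg : ∀ p : ℕ, nordCoeff α i (normalMul α (i, 0) (HahnSeries.single.linearMap 0)) u
      (Int.negSucc p) (-3 + Int.negSucc p + 1 + (0 : ℕ)) =
        ((p : ℂ) + 2) • (X (i, p) * pderiv (i, p + 1) u) := by
    intro p
    rw [nordCoeff, normalMul_single_coeff, ← mul_smul_comm, ← hp]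
    congr 3
    push_cast
    omega
  have hpos : ∀ p : ℕ, nordCoeff α i (normalMul α (i, 0) (HahnSeries.single.linearMap 0)) u
      (p : ℤ) (-3 + p + 1 + (0 : ℕ)) = heis α i (1 - p) (heis α i p u) := by
    intro p
    change (normalMul α (i, 0) (HahnSeries.single.linearMap 0) (heis α i p u)).coeff _ = _
    rw [normalMul_single_coeff]
    congr 2
    push_cast
    ring
  simp only [Ring.choose_zero_right, Int.cast_one, one_smul, hneg, hpos]
  -- The window of radius M + 1 has one creation term more than needed; it vanishes.
  have hM : ((M : ℂ) + 2) • (X (i, M) * pderiv (i, M + 1) u) = 0 := by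
    rw [← mul_smul_comm, ← hp]
    have := h2 (M + 2) (by omega)
    push_cast at this
    rw [this, mul_zero]
  have hs : ∀ p : ℕ, heis α i (1 - ((p + 1 + 1 : ℕ) : ℤ)) (heis α i ((p + 1 + 1 : ℕ) : ℤ) u) =
      ((p : ℂ) + 2) • (X (i, p) * pderiv (i, p + 1) u) := by
    intro p
    rw [show (1 - ((p + 1 + 1 : ℕ) : ℤ)) = -((p : ℤ) + 1) by push_cast; ring, heis_negSucc,
      show (((p + 1 + 1 : ℕ) : ℤ)) = (p : ℤ) + 2 by push_cast; ring, hp, mul_smul_comm]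
  have e0 : heis α i (1 - ((0 : ℕ) : ℤ)) (heis α i ((0 : ℕ) : ℤ) u) = α i • pderiv (i, 0) u := by
    rw [Nat.cast_zero, heis_zero, map_smul, sub_zero, hone]
  have e1 : heis α i (1 - ((0 + 1 : ℕ) : ℤ)) (heis α i ((0 + 1 : ℕ) : ℤ) u) =
      α i • pderiv (i, 0) u := by
    rw [zero_add, Nat.cast_one, sub_self, heis_zero, hone]
  rw [Finset.sum_range_succ (fun p : ℕ => ((p : ℂ) + 2) • (X (i, p) * pderiv (i, p + 1) u)) M, hM,
    Finset.sum_range_succ' _ (M + 1), Finset.sum_range_succ' _ M, e0, e1]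
  simp only [hs]
  rw [two_smul]
  abel

/-- Both sides are derivations applied to u, so it suffices to compare them on the variables of u;
beyond those the cutoff is immaterial. -/
theorem virOne_eventually {l : ℕ} (α : Fin l → ℂ) (u : Fock l) :
    ∀ᶠ M : ℕ in atTop, virOne α u = ∑ i, (α i • pderiv (i, 0) u +
        ∑ p ∈ Finset.range M, ((p : ℂ) + 2) • (X (i, p) * pderiv (i, p + 1) u)) := by
  classical
  filter_upwards [eventually_ge_atTop (u.vars.sup Prod.snd + 1)] with M hM
  have key : virOne α u = (∑ i, (α i • (pderiv (i, 0) : Derivation ℂ (Fock l) (Fock l)) +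
      ∑ p ∈ Finset.range M, ((p : ℂ) + 2) • ((X (i, p) : Fock l) •
        (pderiv (i, p + 1) : Derivation ℂ (Fock l) (Fock l))))) u := by
    refine derivation_eq_of_forall_mem_vars fun s hs => ?_
    have hsM : s.2 < M := by
      have : s.2 ≤ u.vars.sup Prod.snd := Finset.le_sup (f := Prod.snd) hs
      omega
    obtain ⟨j, k⟩ := s
    have hcoe : ∀ {ι : Type} (S : Finset ι) (D : ι → Derivation ℂ (Fock l) (Fock l)) (x : Fock l),
        (∑ i ∈ S, D i) x = ∑ i ∈ S, D i x := fun S D x => by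
      rw [← Derivation.coeFnAddMonoidHom_apply, map_sum, Finset.sum_apply]
      rfl
    simp only [hcoe, Derivation.add_apply, Derivation.smul_apply, smul_eq_mul, pderiv_X,
      Pi.single_apply, Prod.mk.injEq]
    rw [Finset.sum_eq_single j]
    · cases k with
      | zero =>
        rw [virOne_X_zero, Finset.sum_eq_zero]
        · simp [smul_eq_C_mul]
        · intro p _
          simp
      | succ k =>
        rw [virOne_X_succ, Finset.sum_eq_single k]
        · simp
        · intro p _ hp
          simp [Ne.symm hp]
        · intro hk
          simp at hk hsM
          omega
    · intro i _ hi
      simp [Ne.symm hi]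
    · simp
  rw [key, ← Derivation.coeFnAddMonoidHom_apply, map_sum, Finset.sum_apply]
  refine Finset.sum_congr rfl fun i _ => ?_
  rw [Derivation.coeFnAddMonoidHom_apply, Derivation.add_apply, Derivation.smul_apply,
    ← Derivation.coeFnAddMonoidHom_apply (∑ p ∈ Finset.range M, _), map_sum, Finset.sum_apply]
  rfl

theorem coeffShift_zero {l : ℕ} (a κ : ℂ) :
    coeffShift a (0 : HahnSeries ℤ (Fock l)) κ = 0 := by
  rw [coeffShift]; split_ifs <;> simp

theorem coeffShift_add {l : ℕ} (a κ : ℂ) (f g : HahnSeries ℤ (Fock l)) :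
    coeffShift a (f + g) κ = coeffShift a f κ + coeffShift a g κ := by
  simp only [coeffShift]; split_ifs <;> simp

theorem coeffShift_smul {l : ℕ} (a κ r : ℂ) (f : HahnSeries ℤ (Fock l)) :
    coeffShift a (r • f) κ = r • coeffShift a f κ := by
  simp only [coeffShift]; split_ifs <;> simp

theorem coeffShift_of_not {l : ℕ} {a κ : ℂ} (h : ¬∃ n : ℤ, a + n = κ) (f : HahnSeries ℤ (Fock l)) :
    coeffShift a f κ = 0 := by
  rw [coeffShift, dif_neg h]

theorem vertexCoeff_single {l : ℕ} (c : Cocycle l) (α β : Fin l → ℂ) (u v : Fock l) (κ : ℂ) :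
    vertexCoeff c (Finsupp.single α u) κ (Finsupp.single β v) =
      Finsupp.single (α + β)
        ((c.ε α β : ℂ) • coeffShift (α ⬝ᵥ β) (coreField α β u v) κ) := by
  simp only [vertexCoeff, ← coreField_apply]
  rw [Finsupp.sum_single_index, Finsupp.sum_single_index]
  · simp [coeffShift_zero]
  · rw [Finsupp.sum_single_index] <;> simp [coeffShift_zero]

theorem vertexCoeff_add_left {l : ℕ} (c : Cocycle l) (x x' y : BigM l) (κ : ℂ) :
    vertexCoeff c (x + x') κ y = vertexCoeff c x κ y + vertexCoeff c x' κ y := by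
  simp only [vertexCoeff, ← coreField_apply]
  refine Finsupp.sum_add_index' ?_ ?_
  · intro α
    simp [coeffShift_zero]
  · intro α u u'
    simp only [map_add, LinearMap.add_apply, coeffShift_add, smul_add, Finsupp.single_add,
      Finsupp.sum_add]

theorem vertexCoeff_smul_left {l : ℕ} (c : Cocycle l) (r : ℂ) (x y : BigM l) (κ : ℂ) :
    vertexCoeff c (r • x) κ y = r • vertexCoeff c x κ y := by
  simp only [vertexCoeff, ← coreField_apply]
  rw [Finsupp.sum_smul_index', Finsupp.smul_sum]
  · refine Finsupp.sum_congr fun α _ => ?_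
    rw [Finsupp.smul_sum]
    refine Finsupp.sum_congr fun β _ => ?_
    rw [map_smul, LinearMap.smul_apply, coeffShift_smul, Finsupp.smul_single, smul_comm]
  · intro α
    simp [coeffShift_zero]

theorem vertexCoeff_add_right {l : ℕ} (c : Cocycle l) (x y y' : BigM l) (κ : ℂ) :
    vertexCoeff c x κ (y + y') = vertexCoeff c x κ y + vertexCoeff c x κ y' := by
  simp only [vertexCoeff, ← coreField_apply]
  rw [← Finsupp.sum_add]
  refine Finsupp.sum_congr fun α _ => Finsupp.sum_add_index' ?_ ?_
  · intro β
    simp [coeffShift_zero]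
  · intro β v v'
    simp only [map_add, coeffShift_add, smul_add, Finsupp.single_add]

theorem vertexCoeff_smul_right {l : ℕ} (c : Cocycle l) (r : ℂ) (x y : BigM l) (κ : ℂ) :
    vertexCoeff c x κ (r • y) = r • vertexCoeff c x κ y := by
  simp only [vertexCoeff, ← coreField_apply]
  rw [Finsupp.smul_sum]
  refine Finsupp.sum_congr fun α _ => ?_
  rw [Finsupp.sum_smul_index', Finsupp.smul_sum]
  · refine Finsupp.sum_congr fun β _ => ?_
    rw [map_smul, coeffShift_smul, Finsupp.smul_single, smul_comm]
  · intro β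
    simp [coeffShift_zero]

/-- `L(1)` as a linear operator on `ℳ`. -/
def virOneLin {l : ℕ} (c : Cocycle l) : Module.End ℂ (BigM l) where
  toFun := vir c 1
  map_add' x y := vertexCoeff_add_right c _ x y _
  map_smul' r x := vertexCoeff_smul_right c r _ x _

theorem virOneLin_single {l : ℕ} (c : Cocycle l) (α : Fin l → ℂ) (u : Fock l) :
    virOneLin c (Finsupp.single α u) = Finsupp.single α (virOne α u) := by
  change vertexCoeff c (Finsupp.single 0 _) (-((1 : ℤ) : ℂ) - 2) (Finsupp.single α u) = _
  rw [vertexCoeff_single, zero_add, c.zero_left, Units.val_one, one_smul, coreField_apply,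
    coreSeries_zero, show (-((1 : ℤ) : ℂ) - 2) = 0 ⬝ᵥ α + ((-3 : ℤ) : ℂ) by simp; norm_num,
    coeffShift_int]
  obtain ⟨M, h1, h2⟩ := ((virOne_eventually α u).and
    (eventually_all.mpr fun i => heisY_sq_coeff α i u)).exists
  rw [map_smul, map_sum, LinearMap.smul_apply, LinearMap.sum_apply, HahnSeries.coeff_smul,
    HahnSeries.coeff_sum, Finset.sum_congr rfl fun i _ => h2 i, ← Finset.smul_sum, smul_smul, h1]
  norm_num

theorem virOneLin_pow_single {l : ℕ} (c : Cocycle l) (α : Fin l → ℂ) (j : ℕ) (u : Fock l) :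
    (virOneLin c ^ j) (Finsupp.single α u) =
      Finsupp.single α ((j.factorial : ℂ) • virOneDiv α j u) := by
  have h : (virOneLin c ^ j) (Finsupp.single α u) =
      Finsupp.single α (((virOne α).toLinearMap ^ j) u) := by
    induction j with
    | zero => simp
    | succ j ih =>
      rw [pow_succ', Module.End.mul_apply, ih, virOneLin_single, pow_succ', Module.End.mul_apply]
      rfl
  rw [h, virOneDiv, LinearMap.smul_apply, smul_smul,
    mul_inv_cancel₀ (Nat.cast_ne_zero.mpr j.factorial_ne_zero), one_smul]

theorem virOneLin_pow_eventually {l : ℕ} (c : Cocycle l) (x : BigM l) :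
    ∀ᶠ M : ℕ in atTop, ∀ j, M ≤ j → (virOneLin c ^ j) x = 0 := by
  have hadd : ∀ x y : BigM l, (∀ᶠ M : ℕ in atTop, ∀ j, M ≤ j → (virOneLin c ^ j) x = 0) →
      (∀ᶠ M : ℕ in atTop, ∀ j, M ≤ j → (virOneLin c ^ j) y = 0) →
      (∀ᶠ M : ℕ in atTop, ∀ j, M ≤ j → (virOneLin c ^ j) (x + y) = 0) := by
    intro x y hx hy
    filter_upwards [hx, hy] with M h1 h2 j hj
    rw [map_add, h1 j hj, h2 j hj, add_zero]
  induction x using Finsupp.induction_linear with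
  | zero => simp
  | add x y hx hy => exact hadd x y hx hy
  | single α u =>
    induction u using MvPolynomial.induction_on' with
    | add u u' h h' => rw [Finsupp.single_add]; exact hadd _ _ h h'
    | monomial d a =>
      filter_upwards [eventually_ge_atTop (fockWeight d + 1)] with M hM j hj
      rw [show (monomial d a : Fock l) = a • monomial d 1 by rw [smul_monomial]; simp,
        virOneLin_pow_single, map_smul, virOneDiv_monomial_of_lt α d j (by omega)]
      simp

/-! ### Coefficients of the adjoint vertex operator -/

theorem monomial_eq_smul {l : ℕ} (d : Fin l × ℕ →₀ ℕ) (a : ℂ) :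
    (monomial d a : Fock l) = a • monomial d 1 := by
  rw [smul_monomial]; simp

theorem lamPow_add (logLam a b : ℂ) :
    lamPow logLam (a + b) = lamPow logLam a * lamPow logLam b := by
  rw [lamPow, lamPow, lamPow, ← Complex.exp_add, add_mul]

theorem branch_add (N : ℤ) (a b : ℂ) : branch N (a + b) = branch N a * branch N b := by
  rw [branch, branch, branch, ← Complex.exp_add, mul_add]

theorem lamPow_ne_zero (logLam a : ℂ) : lamPow logLam a ≠ 0 := Complex.exp_ne_zero _

/-- The only place where oddness of N enters. -/
theorem branch_int {N : ℤ} (hN : Odd N) (k : ℤ) : branch N k = (-1) ^ k := by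
  have h : branch N k = Complex.exp (Real.pi * Complex.I) ^ (N * k) := by
    rw [branch, ← Complex.exp_int_mul]
    congr 1
    push_cast
    ring
  rw [h, Complex.exp_pi_mul_I, zpow_mul, hN.neg_one_zpow]

theorem scaleL0_single_of_support_subset {l : ℕ} (N : ℤ) (logLam : ℂ) (α : Fin l → ℂ) (u : Fock l)
    {S : Finset (Fin l × ℕ →₀ ℕ)} (hS : u.support ⊆ S) :
    scaleL0 N logLam (Finsupp.single α u) = ∑ d ∈ S, Finsupp.single (-(2 * confWeight α d))
      ((lamPow logLam (2 * confWeight α d) * branch N (-(2 * confWeight α d))) •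
        Finsupp.single α (monomial d (coeff d u))) := by
  rw [scaleL0, Finsupp.sum_single_index (by simp)]
  refine Finset.sum_subset hS fun d _ hd => ?_
  rw [notMem_support_iff.mp hd]
  simp

theorem scaleL0_add {l : ℕ} (N : ℤ) (logLam : ℂ) (x y : BigM l) :
    scaleL0 N logLam (x + y) = scaleL0 N logLam x + scaleL0 N logLam y := by
  classical
  refine Finsupp.sum_add_index' (by simp) fun α u v => ?_
  have h : ∀ u : Fock l, ∑ d ∈ u.support, Finsupp.single (-(2 * confWeight α d))
      ((lamPow logLam (2 * confWeight α d) * branch N (-(2 * confWeight α d))) •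
        Finsupp.single α (monomial d (coeff d u))) = scaleL0 N logLam (Finsupp.single α u) :=
    fun u => (scaleL0_single_of_support_subset N logLam α u subset_rfl).symm
  have h1 : u.support ⊆ u.support ∪ v.support ∪ (u + v).support := fun x hx => by simp_all
  have h2 : v.support ⊆ u.support ∪ v.support ∪ (u + v).support := fun x hx => by simp_all
  have h3 : (u + v).support ⊆ u.support ∪ v.support ∪ (u + v).support := fun x hx => by
    simp only [Finset.mem_union]; exact Or.inr hx
  rw [h, h, h, scaleL0_single_of_support_subset N logLam α u h1,
    scaleL0_single_of_support_subset N logLam α v h2,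
    scaleL0_single_of_support_subset N logLam α _ h3, ← Finset.sum_add_distrib]
  refine Finset.sum_congr rfl fun d _ => ?_
  rw [coeff_add, map_add, Finsupp.single_add, smul_add, Finsupp.single_add]

theorem expL1_term {l : ℕ} (c : Cocycle l) (logLam ρ : ℂ) (x : BigM l) :
    ∀ᶠ M : ℕ in atTop, ∑ᶠ j : ℕ, Finsupp.single (ρ + j)
      (((j.factorial : ℂ)⁻¹ * (-lamPow logLam (-2)) ^ j) • (vir c 1)^[j] x) =
      ∑ j ∈ Finset.range M, Finsupp.single (ρ + j)
      (((j.factorial : ℂ)⁻¹ * (-lamPow logLam (-2)) ^ j) • (virOneLin c ^ j) x) := by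
  have h : ∀ j, (vir c 1)^[j] x = (virOneLin c ^ j) x := fun j => by
    rw [Module.End.pow_apply]; rfl
  simp only [h]
  filter_upwards [virOneLin_pow_eventually c x] with M hM
  refine finsum_eq_sum_of_support_subset _ fun j hj => ?_
  simp only [Finset.coe_range, Set.mem_Iio]
  by_contra hc
  exact hj (by simp [hM j (not_lt.mp hc)])

theorem expL1_single {l : ℕ} (c : Cocycle l) (logLam ρ : ℂ) (x : BigM l) :
    ∀ᶠ M : ℕ in atTop, expL1 c logLam (Finsupp.single ρ x) =
      ∑ j ∈ Finset.range M, Finsupp.single (ρ + j)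
      (((j.factorial : ℂ)⁻¹ * (-lamPow logLam (-2)) ^ j) • (virOneLin c ^ j) x) := by
  filter_upwards [expL1_term c logLam ρ x] with M hM
  rw [expL1, Finsupp.sum_single_index, hM]
  obtain ⟨M, hM⟩ := (expL1_term c logLam ρ 0).exists
  rw [hM]
  simp

theorem expL1_add {l : ℕ} (c : Cocycle l) (logLam : ℂ) (p p' : ℂ →₀ BigM l) :
    expL1 c logLam (p + p') = expL1 c logLam p + expL1 c logLam p' := by
  refine Finsupp.sum_add_index' (fun ρ => ?_) fun ρ x y => ?_
  · obtain ⟨M, hM⟩ := (expL1_term c logLam ρ 0).exists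
    rw [hM]
    simp
  · obtain ⟨M, h1, h2, h3⟩ := ((expL1_term c logLam ρ x).and ((expL1_term c logLam ρ y).and
      (expL1_term c logLam ρ (x + y)))).exists
    rw [h1, h2, h3, ← Finset.sum_add_distrib]
    refine Finset.sum_congr rfl fun j _ => ?_
    rw [map_add, smul_add, Finsupp.single_add]

/-- The substitution of `λ²/(e^{iπN} z)` for `z`, extracting the coefficient of `z^κ`. -/
def substCoeff {l : ℕ} (c : Cocycle l) (N : ℤ) (logLam κ : ℂ) (y : BigM l) :
    (ℂ →₀ BigM l) →ₗ[ℂ] BigM l :=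
  Finsupp.lsum ℂ fun ρ =>
    { toFun := fun x => (lamPow logLam (2 * (ρ - κ)) * branch N (-(ρ - κ))) •
        vertexCoeff c x (ρ - κ) y
      map_add' := fun x x' => by rw [vertexCoeff_add_left, smul_add]
      map_smul' := fun r x => by rw [vertexCoeff_smul_left, smul_comm]; rfl }

theorem daggerCoeff_eq_substCoeff {l : ℕ} (c : Cocycle l) (N : ℤ) (logLam κ : ℂ) (x y : BigM l) :
    daggerCoeff c N logLam x κ y =
      substCoeff c N logLam κ y (expL1 c logLam (scaleL0 N logLam x)) := rfl

theorem substCoeff_single {l : ℕ} (c : Cocycle l) (N : ℤ) (logLam κ ρ : ℂ) (x y : BigM l) :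
    substCoeff c N logLam κ y (Finsupp.single ρ x) =
      (lamPow logLam (2 * (ρ - κ)) * branch N (-(ρ - κ))) • vertexCoeff c x (ρ - κ) y := by
  rw [substCoeff, Finsupp.lsum_single]
  rfl

theorem daggerCoeff_add {l : ℕ} (c : Cocycle l) (N : ℤ) (logLam κ : ℂ) (x x' y : BigM l) :
    daggerCoeff c N logLam (x + x') κ y =
      daggerCoeff c N logLam x κ y + daggerCoeff c N logLam x' κ y := by
  rw [daggerCoeff_eq_substCoeff, scaleL0_add, expL1_add, map_add]
  rfl

/-- A monomial is an L(0)-eigenvector, so scaling gives a single power of z, and only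
e^{-zλ^{-2}L(1)} produces a sum. Its factor 1/j! is absorbed in the divided power. -/
theorem daggerCoeff_monomial {l : ℕ} (c : Cocycle l) (N : ℤ) (logLam κ : ℂ) (α γ : Fin l → ℂ)
    (d : Fin l × ℕ →₀ ℕ) (a : ℂ) (w : Fock l) :
    daggerCoeff c N logLam (Finsupp.single α (monomial d a)) κ (Finsupp.single γ w) =
      Finsupp.single (α + γ) (∑ j ∈ Finset.range (fockWeight d + 1),
        (lamPow logLam (2 * confWeight α d) * branch N (-(2 * confWeight α d)) *
          (-lamPow logLam (-2)) ^ j * (lamPow logLam (2 * (-(2 * confWeight α d) + j - κ)) *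
          branch N (-(-(2 * confWeight α d) + j - κ))) * c.ε α γ) •
          coeffShift (α ⬝ᵥ γ) (coreField α γ (virOneDiv α j (monomial d a)) w)
            (-(2 * confWeight α d) + j - κ)) := by
  classical
  have h0 : scaleL0 N logLam (Finsupp.single α (monomial d a)) =
      Finsupp.single (-(2 * confWeight α d))
      ((lamPow logLam (2 * confWeight α d) * branch N (-(2 * confWeight α d))) •
        Finsupp.single α (monomial d a)) := by
    rw [scaleL0_single_of_support_subset N logLam α _ support_monomial_subset]
    simp
  obtain ⟨M, h1, h2⟩ := ((expL1_single c logLam (-(2 * confWeight α d))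
    ((lamPow logLam (2 * confWeight α d) * branch N (-(2 * confWeight α d))) •
        Finsupp.single α (monomial d a))).and (eventually_ge_atTop (fockWeight d + 1))).exists
  have hzero : ∀ j, fockWeight d < j → virOneDiv α j (monomial d a) = 0 := fun j hj => by
    rw [monomial_eq_smul, map_smul, virOneDiv_monomial_of_lt α d j hj, smul_zero]
  rw [daggerCoeff_eq_substCoeff, h0, h1, map_sum,
    ← Finset.sum_subset (Finset.range_mono h2) fun j _ hj => ?_]
  · rw [← Finsupp.singleAddHom_apply (α + γ), map_sum]
    refine Finset.sum_congr rfl fun j _ => ?_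
    rw [substCoeff_single, map_smul, virOneLin_pow_single, Finsupp.singleAddHom_apply,
      ← Finsupp.smul_single, vertexCoeff_smul_left, vertexCoeff_smul_left, vertexCoeff_smul_left,
      vertexCoeff_single, ← Finsupp.smul_single, ← Finsupp.smul_single, smul_smul, smul_smul,
      smul_smul, smul_smul]
    congr 1
    have hj : (j.factorial : ℂ) ≠ 0 := Nat.cast_ne_zero.mpr j.factorial_ne_zero
    field_simp
  · rw [map_smul, virOneLin_pow_single, hzero j (by simpa using hj), smul_zero, Finsupp.single_zero,
      smul_zero, smul_zero, Finsupp.single_zero, map_zero]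

theorem fieldAdjoint_coreField_monomial {l : ℕ} {q : ℂ} (hq : q ≠ 0) (α β : Fin l → ℂ)
    (d : Fin l × ℕ →₀ ℕ) (a : ℂ) :
    FieldAdjoint q (coreField α β (monomial d a))
      (adjointField q α (-(α + β)) (fockWeight d) (monomial d a)) := by
  intro v w n
  have h := fieldAdjoint_coreField hq α β d v w n
  have h1 : adjointField q α (-(α + β)) (fockWeight d) (monomial d a) =
      a • adjointField q α (-(α + β)) (fockWeight d) (monomial d 1) := by
    rw [monomial_eq_smul, adjointField, adjointField, smul_comm]
    simp only [map_smul, LinearMap.comp_smul, Finset.smul_sum]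
  rw [h1, monomial_eq_smul d a, map_smul, LinearMap.smul_apply, LinearMap.smul_apply,
    HahnSeries.coeff_smul, HahnSeries.coeff_smul, map_smul, map_smul, LinearMap.smul_apply, h,
    smul_eq_mul, smul_eq_mul]
  ring

/-! ### The invariant bilinear form -/

/-- The invariant bilinear form on `ℳ`. -/
def bigForm {l : ℕ} (c : Cocycle l) (logLam : ℂ) : LinearMap.BilinForm ℂ (BigM l) :=
  Finsupp.lsum ℂ fun β => ((c.ε β (-β) : ℂ) * lamPow logLam (-(β ⬝ᵥ β))) •
    (fockForm (-lamPow logLam 2)).compl₂ (Finsupp.lapply (-β))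

theorem bigForm_single_left {l : ℕ} (c : Cocycle l) (logLam : ℂ) (β : Fin l → ℂ) (v : Fock l)
    (y : BigM l) : bigForm c logLam (Finsupp.single β v) y =
      (c.ε β (-β) : ℂ) * lamPow logLam (-(β ⬝ᵥ β)) * fockForm (-lamPow logLam 2) v (y (-β)) := by
  rw [bigForm, Finsupp.lsum_single]
  simp

theorem bigForm_single {l : ℕ} (c : Cocycle l) (logLam : ℂ) (β γ : Fin l → ℂ) (v w : Fock l) :
    bigForm c logLam (Finsupp.single β v) (Finsupp.single γ w) =
      (c.ε β (-β) : ℂ) * lamPow logLam (-(β ⬝ᵥ β)) * (if β + γ = 0 then 1 else 0) *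
        fockForm (-lamPow logLam 2) v w := by
  rw [bigForm_single_left]
  split_ifs with h
  · rw [← eq_neg_of_add_eq_zero_right h, Finsupp.single_eq_same, mul_one]
  · rw [Finsupp.single_eq_of_ne fun h' => h (by rw [← h']; abel)]
    simp

/-- For a monomial u both sides vanish unless α + β + γ = 0 and κ - α·β is an integer. In the
remaining case `fieldAdjoint_coreField_monomial` gives the same vectors on both sides, and the
scalars are compared for each power of L(1) separately. -/
theorem isInvariant_bigForm {l : ℕ} (c : Cocycle l) {N : ℤ} (hN : Odd N) (logLam : ℂ) :
    IsInvariant c N logLam (bigForm c logLam) := by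
  intro α β γ u v w κ
  induction u using MvPolynomial.induction_on' with
  | add u u' h h' =>
    rw [Finsupp.single_add, vertexCoeff_add_left, map_add, LinearMap.add_apply, h, h',
      daggerCoeff_add, map_add]
    ring
  | monomial d a =>
    have ht : lamPow logLam 2 ≠ 0 := lamPow_ne_zero _ _
    set q := -lamPow logLam 2 with hqdef
    have hq : q ≠ 0 := neg_ne_zero.mpr ht
    rw [vertexCoeff_single, daggerCoeff_monomial, bigForm_single, bigForm_single, ← hqdef]
    by_cases hsum : α + β + γ = 0
    swap
    · rw [if_neg hsum, if_neg (fun h => hsum (by rw [← h]; abel))]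
      simp
    rw [if_pos hsum, if_pos (by rw [← hsum]; abel)]
    obtain rfl : γ = -(α + β) := eq_neg_of_add_eq_zero_right hsum
    set n := fockWeight d with hn
    have hdot : α ⬝ᵥ (-(α + β)) = -(α ⬝ᵥ α) - α ⬝ᵥ β := by
      rw [dotProduct_neg, dotProduct_add]; ring
    have hdot2 : (α + β) ⬝ᵥ (α + β) = α ⬝ᵥ α + 2 * (α ⬝ᵥ β) + β ⬝ᵥ β := by
      rw [dotProduct_add, add_dotProduct, add_dotProduct, dotProduct_comm β α]; ring
    have hconf : 2 * confWeight α d = 2 * n + α ⬝ᵥ α := by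
      rw [confWeight, ← hn]; ring
    by_cases hκ : ∃ m : ℤ, α ⬝ᵥ β + m = κ
    swap
    · rw [coeffShift_of_not hκ, Finset.sum_eq_zero]
      · simp
      · intro j _
        rw [coeffShift_of_not, smul_zero]
        rintro ⟨k, hk⟩
        refine hκ ⟨j - 2 * n - k, ?_⟩
        rw [hdot, hconf] at hk
        push_cast
        linear_combination -hk
    obtain ⟨m, rfl⟩ := hκ
    have hμ : ∀ j : ℕ, -(2 * confWeight α d) + j - (α ⬝ᵥ β + m) =
        α ⬝ᵥ (-(α + β)) + ((j - 2 * n - m : ℤ) : ℂ) := fun j => by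
      rw [hdot, hconf]; push_cast; ring
    simp only [hμ, coeffShift_int]
    have hadj := fieldAdjoint_coreField_monomial hq α β d a v w m
    rw [map_smul, LinearMap.smul_apply, smul_eq_mul, hadj, ← hn, map_sum, adjointField,
      LinearMap.smul_apply, LinearMap.sum_apply, HahnSeries.coeff_smul, HahnSeries.coeff_sum,
      map_smul, map_sum, smul_eq_mul]
    simp only [Finset.mul_sum]
    refine Finset.sum_congr rfl fun j _ => ?_
    rw [LinearMap.comp_apply, zMul_coeff, map_smul, smul_eq_mul,
      show -m - (2 * (n : ℤ) - j) = j - 2 * n - m by ring]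
    set F := fockForm q v _
    -- The cocycle law at (β, α, -(α+β)), with ε(β,α) exchanged for ε(α,β) at the cost of C(α,β).
    have hcoc : (c.ε α β : ℂ) * c.ε (α + β) (-(α + β)) =
        c.comm α β * c.ε α (-(α + β)) * c.ε β (-β) := by
      have h := c.cocycle β α (-(α + β))
      rw [show α + -(α + β) = -β by abel, add_comm β α] at h
      have h' : c.ε α β * c.ε (α + β) (-(α + β)) =
          c.comm α β * c.ε α (-(α + β)) * c.ε β (-β) := by
        rw [Cocycle.comm, mul_assoc, mul_comm (c.ε α (-(α + β))), h, ← mul_assoc, div_mul_cancel]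
      exact_mod_cast congrArg Units.val h'
    have hlam : lamPow logLam (-((α + β) ⬝ᵥ (α + β))) * (q ^ (-m) * (-q) ^ (-(n : ℤ))) =
        branch N (-(α ⬝ᵥ β)) * lamPow logLam (-(β ⬝ᵥ β)) *
        (lamPow logLam (2 * confWeight α d) * branch N (-(2 * confWeight α d)) *
          (-lamPow logLam (-2)) ^ j *
          (lamPow logLam (2 * (α ⬝ᵥ (-(α + β)) + ((j - 2 * n - m : ℤ) : ℂ))) *
          branch N (-(α ⬝ᵥ (-(α + β)) + ((j - 2 * n - m : ℤ) : ℂ))))) := by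
      have hpow : ∀ k : ℤ, lamPow logLam 2 ^ k = lamPow logLam (2 * k) := fun k => by
        rw [lamPow, lamPow, ← Complex.exp_int_mul]; congr 1; ring
      have h1 : q ^ (-m) = (-1) ^ (-m) * lamPow logLam (2 * (-m : ℤ)) := by
        rw [hqdef, ← neg_one_mul, mul_zpow, hpow]
      have h2 : (-q) ^ (-(n : ℤ)) = lamPow logLam (2 * (-(n : ℤ) : ℤ)) := by
        rw [hqdef, neg_neg, hpow]
      have h3 : (-lamPow logLam (-2)) ^ j = (-1) ^ (j : ℤ) * lamPow logLam (-2 * j) := by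
        rw [← neg_one_mul, mul_pow, zpow_natCast]
        congr 1
        rw [lamPow, lamPow, ← Complex.exp_nat_mul]; congr 1; ring
      -- The complex exponents α·α and α·β cancel and leave the integer m - j. The factor e^{-iπN
      -- α·β} in the definition of invariance is there to make this happen.
      have h4 : branch N (-(α ⬝ᵥ β)) * branch N (-(2 * confWeight α d)) *
          branch N (-(α ⬝ᵥ (-(α + β)) + ((j - 2 * n - m : ℤ) : ℂ))) = (-1) ^ (m - j) := by
        rw [← branch_add, ← branch_add, ← branch_int hN]
        congr 1
        rw [hdot, hconf]
        push_cast
        ring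
      have h5 : lamPow logLam (-((α + β) ⬝ᵥ (α + β))) * lamPow logLam (2 * (-m : ℤ)) *
          lamPow logLam (2 * (-(n : ℤ) : ℤ)) = lamPow logLam (-(β ⬝ᵥ β)) *
          lamPow logLam (2 * confWeight α d) * lamPow logLam (-2 * j) *
          lamPow logLam (2 * (α ⬝ᵥ (-(α + β)) + ((j - 2 * n - m : ℤ) : ℂ))) := by
        simp only [← lamPow_add]
        congr 1
        rw [hdot, hconf, hdot2]
        push_cast
        ring
      have h6 : ((-1 : ℂ)) ^ (-m) = (-1) ^ (m - j) * (-1) ^ (j : ℤ) := by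
        rw [← zpow_add₀ (by norm_num), sub_add_cancel, zpow_neg, ← inv_zpow]
        norm_num
      rw [h1, h2, h3]
      linear_combination (-1) ^ (-m) * h5 + lamPow logLam (-(β ⬝ᵥ β)) *
          lamPow logLam (2 * confWeight α d) * lamPow logLam (-2 * j) *
          lamPow logLam (2 * (α ⬝ᵥ (-(α + β)) + ((j - 2 * n - m : ℤ) : ℂ))) *
          (h6 - (-1) ^ (j : ℤ) * h4)
    linear_combination F * (c.ε α β : ℂ) * c.ε (α + β) (-(α + β)) * hlam +
      F * (branch N (-(α ⬝ᵥ β)) * lamPow logLam (-(β ⬝ᵥ β)) *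
        (lamPow logLam (2 * confWeight α d) * branch N (-(2 * confWeight α d)) *
          (-lamPow logLam (-2)) ^ j *
          (lamPow logLam (2 * (α ⬝ᵥ (-(α + β)) + ((j - 2 * n - m : ℤ) : ℂ))) *
          branch N (-(α ⬝ᵥ (-(α + β)) + ((j - 2 * n - m : ℤ) : ℂ)))))) * hcoc

/-! ### Uniqueness of the invariant form -/

theorem coreField_zero_X {l : ℕ} (β : Fin l → ℂ) (i : Fin l) (v : Fock l) (n : ℤ) :
    (coreField 0 β (X (i, 0)) v).coeff n = heis β i (-n - 1) v := by
  rw [coreField_apply, coreSeries_zero, ← mul_one (X (i, 0)), heisY_X_mul, heisY_one,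
    normalMul_single_coeff]

/-- The adjoint of a Heisenberg mode with respect to an invariant form. -/
theorem IsInvariant.heis_adjoint {l : ℕ} {c : Cocycle l} {N : ℤ} (hN : Odd N) {logLam : ℂ}
    {B : LinearMap.BilinForm ℂ (BigM l)} (hB : IsInvariant c N logLam B) (β γ : Fin l → ℂ)
    (i : Fin l) (m : ℤ) (v w : Fock l) :
    B (Finsupp.single β (heis β i m v)) (Finsupp.single γ w) =
      -((-lamPow logLam 2) ^ m) *
        B (Finsupp.single β v) (Finsupp.single γ (heis γ i (-m) w)) := by
  -- The coefficient of z^{-m-1} in a^i(z) is the mode a^i(m).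
  have h := hB 0 β γ (X (i, 0)) v w (0 ⬝ᵥ β + ((-m - 1 : ℤ) : ℂ))
  have hL : vertexCoeff c (Finsupp.single 0 (X (i, 0))) (0 ⬝ᵥ β + ((-m - 1 : ℤ) : ℂ))
      (Finsupp.single β v) = Finsupp.single β (heis β i m v) := by
    rw [vertexCoeff_single, coeffShift_int, coreField_zero_X, c.zero_left, zero_add,
      Units.val_one, one_smul, show -(-m - 1) - 1 = m by ring]
  have hR : daggerCoeff c N logLam (Finsupp.single 0 (X (i, 0))) (0 ⬝ᵥ β + ((-m - 1 : ℤ) : ℂ))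
      (Finsupp.single γ w) = -((-lamPow logLam 2) ^ m) •
        Finsupp.single γ (heis γ i (-m) w) := by
    have hw : fockWeight (Finsupp.single ((i, 0) : Fin l × ℕ) 1) = 1 := by
      rw [fockWeight_single, one_mul]
    have hc : 2 * confWeight (0 : Fin l → ℂ) (Finsupp.single (i, 0) 1) = 2 := by
      rw [confWeight, hw]; simp
    -- At momentum zero a^i(-1)𝟏 is primary, so the L(1)-correction disappears.
    have h1 : virOneDiv (0 : Fin l → ℂ) 1 (X (i, 0)) = 0 := by
      rw [virOneDiv_succ_X]; simp
    have hμ : -2 + ((0 : ℕ) : ℂ) - (0 ⬝ᵥ β + ((-m - 1 : ℤ) : ℂ)) =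
        0 ⬝ᵥ γ + ((m - 1 : ℤ) : ℂ) := by
      rw [zero_dotProduct, zero_dotProduct]; push_cast; ring
    have hX := daggerCoeff_monomial c N logLam (0 ⬝ᵥ β + ((-m - 1 : ℤ) : ℂ)) 0 γ
      (Finsupp.single ((i, 0) : Fin l × ℕ) 1) 1 w
    change daggerCoeff c N logLam (Finsupp.single 0 (monomial (Finsupp.single (i, 0) 1) 1)) _ _ = _
    rw [hX, hw, hc, Finset.sum_range_succ, Finset.sum_range_one]
    change Finsupp.single _ (_ • coeffShift _ (coreField 0 γ (virOneDiv 0 0 (X (i, 0))) w) _ +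
      _ • coeffShift _ (coreField 0 γ (virOneDiv 0 1 (X (i, 0))) w) _) = _
    rw [h1, map_zero, LinearMap.zero_apply, coeffShift_zero, smul_zero, add_zero, virOneDiv_zero,
      hμ, coeffShift_int, coreField_zero_X, c.zero_left, zero_add, Finsupp.smul_single,
      show -(m - 1) - 1 = -m by ring]
    congr 2
    have e1 : branch N (-2) = 1 := by
      have := branch_int hN (-2)
      push_cast at this
      rw [this]
      norm_num
    have e2 : branch N (-(0 ⬝ᵥ γ + ((m - 1 : ℤ) : ℂ))) = -(-1) ^ m := by
      rw [zero_dotProduct, zero_add, ← Int.cast_neg, branch_int hN, neg_sub,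
        zpow_sub₀ (by norm_num), zpow_one]
      rcases Int.even_or_odd m with h | h
      · simp [h.neg_one_zpow]
      · simp [h.neg_one_zpow]
    have e3 : lamPow logLam (2 * (0 ⬝ᵥ γ + ((m - 1 : ℤ) : ℂ))) * lamPow logLam 2 =
        lamPow logLam 2 ^ m := by
      rw [← lamPow_add, lamPow, lamPow, ← Complex.exp_int_mul, zero_dotProduct]
      congr 1
      push_cast
      ring
    rw [e1, e2, neg_eq_neg_one_mul (lamPow logLam 2), mul_zpow, ← e3]
    simp
    ring
  rw [hL, hR] at h
  rw [h, map_smul, Cocycle.comm, c.zero_left, c.zero_right, zero_dotProduct]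
  simp [branch]

theorem Yplus_coeff_one {l : ℕ} (α : Fin l → ℂ) (m : ℕ) :
    PowerSeries.coeff m (Yplus α) (1 : Fock l) = if m = 0 then 1 else 0 := by
  split_ifs with h
  · subst h
    simp [Yplus, expSeries]
  · refine weightLT_zero ?_
    have h1 : (1 : Fock l) ∈ weightLT l 1 := by
      classical
      intro d hd
      rw [coeff_one] at hd
      have : 0 = d := by by_contra hc; simp [hc] at hd
      rw [← this]
      simp [fockWeight]
    have := lowersWeight_Yplus α m 1 1 h1
    rwa [Nat.sub_eq_zero_of_le (by omega)] at this

theorem coreField_one_one {l : ℕ} (α β : Fin l → ℂ) :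
    (coreField α β 1 1).coeff 0 = 1 := by
  rw [coreField_apply, coreSeries, finsum_eq_single _ 0]
  · have h1 : heisY β 1 (PowerSeries.coeff 0 (Yplus α) (1 : Fock l)) =
        HahnSeries.single 0 1 := by
      rw [Yplus_coeff_one, if_pos rfl, heisY_one]
      rfl
    rw [h1, HahnSeries.single_mul_single, HahnSeries.coeff_mul_single, Nat.cast_zero, neg_zero,
      add_zero, sub_zero, mul_one, mul_one, ← Nat.cast_zero, HahnSeries.ofPowerSeries_apply_coeff]
    simp [Yminus, expSeries]
  · intro m hm
    rw [Yplus_coeff_one, if_neg hm, map_zero, mul_zero]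

/-- Only invariance for the generators a^i(-1)𝟏 and for the vectors e^β is needed: they produce all
of ℳ from 𝟏. -/
theorem IsInvariant.eq_zero {l : ℕ} {c : Cocycle l} {N : ℤ} (hN : Odd N) {logLam : ℂ}
    {B : LinearMap.BilinForm ℂ (BigM l)} (hB : IsInvariant c N logLam B)
    (h0 : B (vac l) (vac l) = 0) : B = 0 := by
  have hq : -lamPow logLam 2 ≠ 0 := neg_ne_zero.mpr (lamPow_ne_zero _ _)
  have right : ∀ β, (∀ γ, B (Finsupp.single β 1) (Finsupp.single γ 1) = 0) →
      ∀ γ w, B (Finsupp.single β 1) (Finsupp.single γ w) = 0 := by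
    intro β h γ w
    induction w using MvPolynomial.induction_on' with
    | add w w' h h' => rw [Finsupp.single_add, map_add, h, h', add_zero]
    | monomial d a =>
      rw [monomial_eq_smul, ← Finsupp.smul_single, map_smul, smul_eq_mul]
      refine mul_eq_zero_of_right _ ?_
      induction d using exponent_induction with
      | h0 => exact h γ
      | h s d _ =>
        -- The creation operator on the right is, up to a nonzero factor, the adjoint of an
        -- annihilation operator, which kills e^β.
        have h1 := hB.heis_adjoint hN β γ s.1 (s.2 + 1) 1 (monomial d 1)
        rw [heis_add_one, heis_negSucc, X_mul_monomial] at h1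
        simp only [LinearMap.smul_apply, Derivation.coeFn_coe, pderiv_one, smul_zero,
          Finsupp.single_zero, map_zero, LinearMap.zero_apply] at h1
        have h2 := mul_eq_zero.mp h1.symm
        exact h2.resolve_left (neg_ne_zero.mpr (zpow_ne_zero _ hq))
  have zero : ∀ γ w, B (Finsupp.single 0 1) (Finsupp.single γ w) = 0 := by
    refine right 0 fun γ => ?_
    by_cases hγ : γ = 0
    · rw [hγ]; exact h0
    -- The zero mode a^i(0) acts as 0 on 𝟏 and as γ^i ≠ 0 on e^γ.
    · obtain ⟨i, hi⟩ := Function.ne_iff.mp hγ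
      have h1 := hB.heis_adjoint hN 0 γ i 0 1 1
      rw [neg_zero, heis_zero, heis_zero, ← Finsupp.smul_single _ γ, map_smul] at h1
      have hi' : γ i ≠ 0 := hi
      simpa [hi'] using h1
  have one : ∀ β γ, B (Finsupp.single β 1) (Finsupp.single γ 1) = 0 := by
    intro β γ
    -- The constant coefficient of 𝒴(e^β, z)𝟏 is e^β; invariance moves the vertex operator to the
    -- right and leaves 𝟏 on the left.
    have h := hB β 0 γ 1 1 1 (β ⬝ᵥ 0 + ((0 : ℤ) : ℂ))
    rw [vertexCoeff_single, coeffShift_int, coreField_one_one, add_zero, c.zero_right,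
      Units.val_one, one_smul] at h
    rw [h]
    change _ * B _ (daggerCoeff c N logLam (Finsupp.single β (monomial 0 1)) _ _) = 0
    rw [daggerCoeff_monomial, zero, mul_zero]
  have left : ∀ β v γ w, B (Finsupp.single β v) (Finsupp.single γ w) = 0 := by
    intro β v
    induction v using MvPolynomial.induction_on' with
    | add v v' h h' =>
      intro γ w
      rw [Finsupp.single_add, map_add, LinearMap.add_apply, h, h', add_zero]
    | monomial d a =>
      have key : ∀ γ w, B (Finsupp.single β (monomial d 1)) (Finsupp.single γ w) = 0 := by
        induction d using exponent_induction with
        | h0 => exact right β (one β)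
        | h s d ih =>
          intro γ w
          rw [← X_mul_monomial, ← heis_negSucc β s.1 s.2, hB.heis_adjoint hN, ih, mul_zero]
      intro γ w
      rw [monomial_eq_smul, ← Finsupp.smul_single, map_smul, LinearMap.smul_apply, key, smul_zero]
  refine Finsupp.lhom_ext fun β v => LinearMap.ext fun y => ?_
  induction y using Finsupp.induction_linear with
  | zero => simp
  | add y y' h h' => rw [map_add, h, h', map_add]
  | single γ w => rw [left]; simp

theorem IsInvariant.sub {l : ℕ} {c : Cocycle l} {N : ℤ} {logLam : ℂ}
    {B B' : LinearMap.BilinForm ℂ (BigM l)} (hB : IsInvariant c N logLam B)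
    (hB' : IsInvariant c N logLam B') : IsInvariant c N logLam (B - B') := by
  intro α β γ u v w κ
  simp only [LinearMap.sub_apply]
  rw [hB, hB', mul_sub]

/-! ### Symmetry and invertibility -/

/-- The constant `⟨e^β, e^{-β}⟩`. -/
def pairingConst {l : ℕ} (c : Cocycle l) (logLam : ℂ) (β : Fin l → ℂ) : ℂ :=
  (c.ε β (-β) : ℂ) * lamPow logLam (-(β ⬝ᵥ β))

theorem pairingConst_ne_zero {l : ℕ} (c : Cocycle l) (logLam : ℂ) (β : Fin l → ℂ) :
    pairingConst c logLam β ≠ 0 :=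
  mul_ne_zero (Units.ne_zero _) (lamPow_ne_zero _ _)

theorem pairingConst_neg {l : ℕ} (c : Cocycle l) (logLam : ℂ) (β : Fin l → ℂ) :
    pairingConst c logLam (-β) = pairingConst c logLam β := by
  -- At (β, -β, β) the cocycle law reduces to ε(-β,β) = ε(β,-β).
  have h := c.cocycle β (-β) β
  rw [neg_add_cancel, add_neg_cancel, c.zero_left, c.zero_right, one_mul, mul_one] at h
  rw [pairingConst, pairingConst, neg_neg, h, neg_dotProduct_neg]

theorem bigForm_comm {l : ℕ} (c : Cocycle l) (logLam : ℂ) (x y : BigM l) :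
    bigForm c logLam x y = bigForm c logLam y x := by
  induction x using Finsupp.induction_linear with
  | zero => simp
  | add x x' h h' => rw [map_add, LinearMap.add_apply, h, h', map_add]
  | single β v =>
    induction y using Finsupp.induction_linear with
    | zero => simp
    | add y y' h h' => rw [map_add, h, h', map_add, LinearMap.add_apply]
    | single γ w =>
      have h := pairingConst_neg c logLam β
      rw [bigForm_single, bigForm_single, fockForm_comm]
      by_cases hs : β + γ = 0
      · obtain rfl : γ = -β := eq_neg_of_add_eq_zero_right hs
        simp only [pairingConst] at h
        rw [h, if_pos hs, if_pos (by rw [neg_add_cancel])]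
      · rw [if_neg hs, if_neg (by rwa [add_comm])]
        simp

theorem bigForm_single_right {l : ℕ} (c : Cocycle l) (logLam : ℂ) (x : BigM l) (β : Fin l → ℂ)
    (w : Fock l) : bigForm c logLam x (Finsupp.single β w) =
      pairingConst c logLam β * fockForm (-lamPow logLam 2) w (x (-β)) := by
  rw [bigForm_comm, bigForm_single_left, pairingConst]

theorem eq_zero_of_bigForm {l : ℕ} (c : Cocycle l) (logLam : ℂ) (x : BigM l)
    (h : ∀ y, bigForm c logLam x y = 0) : x = 0 := by
  refine Finsupp.ext fun β => ?_
  refine fockForm_nondegenerate (neg_ne_zero.mpr (lamPow_ne_zero logLam 2)) _ fun w => ?_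
  have h1 := h (Finsupp.single (-β) w)
  rw [bigForm_single_right, neg_neg] at h1
  exact (mul_eq_zero.mp h1).resolve_left (pairingConst_ne_zero _ _ _)

theorem exists_coeff_of_fockForm_ne_zero {l : ℕ} {q : ℂ} {u w : Fock l}
    (h : fockForm q u w ≠ 0) : ∃ d, coeff d u ≠ 0 ∧ coeff d w ≠ 0 := by
  by_contra! hc
  refine h ?_
  rw [u.as_sum, map_sum, LinearMap.sum_apply]
  refine Finset.sum_eq_zero fun d hd => ?_
  rw [fockForm_monomial, hc d (mem_support_iff.mp hd), mul_zero]

/-- Each d s * (s.2 + 1) is at most the weight n, which bounds both the support and the exponents.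
-/
theorem finite_fockWeight_eq (l n : ℕ) : {d : Fin l × ℕ →₀ ℕ | fockWeight d = n}.Finite := by
  classical
  refine (Finset.finite_toSet (Finset.finsupp (Finset.univ ×ˢ Finset.range n)
    fun _ => Finset.range (n + 1))).subset fun d hd => ?_
  have hle : ∀ s, d s * (s.2 + 1) ≤ n := by
    intro s
    by_cases hs : s ∈ d.support
    · rw [← hd.out, fockWeight, Finsupp.weight_apply, Finsupp.sum]
      exact Finset.single_le_sum (f := fun s : Fin l × ℕ => d s • (s.2 + 1))
        (fun _ _ => Nat.zero_le _) hs
    · rw [Finsupp.notMem_support_iff.mp hs]; simp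
  rw [Finset.mem_coe, Finset.mem_finsupp_iff]
  have hsub : d.support ⊆ Finset.univ ×ˢ Finset.range n := by
    intro s hs
    have h1 : 1 ≤ d s := Nat.one_le_iff_ne_zero.mpr (Finsupp.mem_support_iff.mp hs)
    have h2 := hle s
    simp only [Finset.mem_product, Finset.mem_univ, Finset.mem_range, true_and]
    nlinarith
  refine ⟨hsub, fun s _ => ?_⟩
  have h2 := hle s
  rw [Finset.mem_range]
  nlinarith [Nat.zero_le (d s * s.2)]

/-- A vector involves finitely many monomials, and each pairs nontrivially with only one space
M_{β,n}. Conversely, finiteness of the monomials in every weight makes a functional in the graded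
dual nonzero on only finitely many monomials, so it is represented by a finite sum in the dual
basis. -/
theorem range_bigForm {l : ℕ} (c : Cocycle l) (logLam : ℂ) :
    Set.range (bigForm c logLam) = gradedDual l := by
  classical
  have hq : -lamPow logLam 2 ≠ 0 := neg_ne_zero.mpr (lamPow_ne_zero _ _)
  ext f
  constructor
  · rintro ⟨x, rfl⟩
    refine (Finset.finite_toSet (x.support.biUnion fun β =>
      (x β).support.image fun d => (-β, fockWeight d))).subset ?_
    rintro ⟨β, n⟩ ⟨u, hu, hne⟩
    rw [bigForm_single_right] at hne
    obtain ⟨d, h1, h2⟩ := exists_coeff_of_fockForm_ne_zero (right_ne_zero_of_mul hne)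
    simp only [Finset.coe_biUnion, Set.mem_iUnion, Finset.coe_image, Set.mem_image]
    refine ⟨-β, ?_, d, ?_, ?_⟩
    · rw [Finset.mem_coe, Finsupp.mem_support_iff]
      intro h0
      rw [h0] at h2
      exact h2 (coeff_zero d)
    · rw [Finset.mem_coe]
      exact mem_support_iff.mpr h2
    · rw [neg_neg]
      exact congrArg _ (hu h1)
  · intro hf
    have hfin : {p : (Fin l → ℂ) × (Fin l × ℕ →₀ ℕ) |
        f (Finsupp.single p.1 (monomial p.2 1)) ≠ 0}.Finite := by
      refine (Set.Finite.biUnion hf fun p _ =>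
        (Set.finite_singleton p.1).prod (finite_fockWeight_eq l p.2)).subset fun p hp => ?_
      rw [Set.mem_iUnion₂]
      refine ⟨(p.1, fockWeight p.2), ⟨monomial p.2 1, ?_, hp⟩, rfl, rfl⟩
      exact isWeightedHomogeneous_monomial _ _ _ rfl
    -- Up to the scalar in the denominator, the monomial d in M_{-β} is dual to the same monomial in
    -- M_β.
    refine ⟨∑ p ∈ hfin.toFinset, Finsupp.single (-p.1) (monomial p.2
      (f (Finsupp.single p.1 (monomial p.2 1)) /
        (pairingConst c logLam p.1 * normMonomial (-lamPow logLam 2) p.2))), ?_⟩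
    refine Finsupp.lhom_ext fun β w => ?_
    induction w using MvPolynomial.induction_on' with
    | add w w' h h' => rw [Finsupp.single_add, map_add, map_add, h, h']
    | monomial e a =>
      rw [monomial_eq_smul, ← Finsupp.smul_single, map_smul, map_smul]
      congr 1
      rw [bigForm_single_right, fockForm_monomial, one_mul, Finsupp.finsetSum_apply, coeff_sum,
        Finset.sum_eq_single (β, e)]
      · rw [Finsupp.single_eq_same, coeff_monomial, if_pos rfl]
        have h1 := pairingConst_ne_zero c logLam β
        have h2 := normMonomial_ne_zero hq e
        field_simp
      · rintro ⟨β', e'⟩ _ hne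
        by_cases hβ : β' = β
        · subst hβ
          rw [Finsupp.single_eq_same, coeff_monomial, if_neg]
          rintro rfl
          exact hne rfl
        · rw [Finsupp.single_eq_of_ne (by simpa using Ne.symm hβ), coeff_zero]
      · intro h
        simp only [Set.Finite.mem_toFinset, Set.mem_ofPred_eq, not_not] at h
        rw [h]
        simp

end HeisGVOA

end

open HeisGVOA in
/-- Existence, uniqueness, symmetry, invertibility and explicit form of the normalized invariant
bilinear form. Here `λ = exp logLam` and `λ^κ = exp (κ logLam)`. -/
theorem mainTheorem6 (l : ℕ) (c : Cocycle l) (N : ℤ) (hN : Odd N) (logLam : ℂ) :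
    ∃ B : LinearMap.BilinForm ℂ (BigM l),
      (IsInvariant c N logLam B ∧ B (vac l) (vac l) = 1) ∧
      (∀ B' : LinearMap.BilinForm ℂ (BigM l),
        IsInvariant c N logLam B' → B' (vac l) (vac l) = 1 → B' = B) ∧
      B.IsSymm ∧ B.Nondegenerate ∧ IsInvertible B ∧
      ∀ (β γ : Fin l → ℂ) (v w : Fock l),
        B (Finsupp.single β v) (Finsupp.single γ w) =
          (c.ε β (-β) : ℂ) * lamPow logLam (-(β ⬝ᵥ β)) * (if β + γ = 0 then 1 else 0) *
            B (Finsupp.single 0 v) (Finsupp.single 0 w) := by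
  have hinv := isInvariant_bigForm c hN logLam
  have hfock : ∀ v w : Fock l, bigForm c logLam (Finsupp.single 0 v) (Finsupp.single 0 w) =
      fockForm (-lamPow logLam 2) v w := fun v w => by
    rw [bigForm_single, c.zero_left]
    simp [lamPow]
  have hone : bigForm c logLam (vac l) (vac l) = 1 := by
    rw [vac, hfock, fockForm_one]
  refine ⟨bigForm c logLam, ⟨hinv, hone⟩, fun B' hB' h1 => ?_, ⟨bigForm_comm c logLam⟩,
    ⟨eq_zero_of_bigForm c logLam, fun y hy => eq_zero_of_bigForm c logLam y fun x => ?_⟩,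
    ⟨?_, range_bigForm c logLam⟩, fun β γ v w => ?_⟩
  · refine sub_eq_zero.mp ((hB'.sub hinv).eq_zero hN ?_)
    rw [LinearMap.sub_apply, LinearMap.sub_apply, h1, hone, sub_self]
  · rw [bigForm_comm, hy]
  · refine (injective_iff_map_eq_zero _).mpr fun x hx => eq_zero_of_bigForm c logLam x fun y => ?_
    rw [hx, LinearMap.zero_apply]
  · rw [hfock, bigForm_single]
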